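/- Let $k$ be a field with $\mathrm{char}(k)=0$, let $Q_A$ be a finite quiver, let $I_A$ be an admissible ideal of the path algebra $kQ_A$, and suppose that $A=kQ_A/I_A$ is a radical square zero algebra (so $I_A$ is generated by the set $Z_A$ of all paths of length $2$). Let $\alpha:e_1\to e_2$ and $\beta:e_{n-1}\to e_n$ be two arrows of $Q_A$ such that the four vertices $e_1,e_2,e_{n-1},e_n$ are pairwise different and such that $\alpha$ and $\beta$ belong to the same block of $A$ ($A$ itself may have several blocks). Let $B$ be the algebra obtained from $A$ by gluing $\alpha$ and $\beta$, that is, the subalgebra of $A$ generated by $f_1=e_1+e_{n-1}$, $f_2=e_2+e_n$, the idempotents $f_i=e_i$ at the other vertices, $\gamma^*=\alpha+\beta$, and all arrows of $Q_A$ other than $\alpha,\beta$. Let $Q_B$ be the quiver obtained from $Q_A$ by identifying $\alpha$ with $\beta$ (hence $e_1$ with $e_{n-1}$ and $e_2$ with $e_n$). For an arrow $a$ or a path $p$ of $Q_A$ write $a^*$, $p^*$ for its image in $Q_B$; in particular $\alpha^*=\beta^*=\gamma^*$. Then $B\cong kQ_B/I_B$, where $I_B$ is generated by the images of the paths in $Z_A$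 together with the newly formed paths $Z_{new}$ (paths written from right to left): $$Z_{new}=\{\lambda^*\eta^*,\ \xi^*\mu^*,\ \xi^*\gamma^*\eta^* \mid t(\eta)=e_1,\ t(\mu)=e_2\,(\mu\ne\alpha),\ s(\lambda)=e_{n-1}\,(\lambda\neq\beta),\ s(\xi)=e_n\}$$ $$\cup\ \{\lambda^*\eta^*,\ \xi^*\mu^*,\ \xi^*\gamma^*\eta^* \mid t(\eta)=e_{n-1},\ t(\mu)=e_n\,(\mu\ne\beta),\ s(\lambda)=e_{1}\,(\lambda\neq\alpha),\ s(\xi)=e_2\}.$$ Let $Z_B$ be the minimal set of paths generating $I_B$, and let $\mathcal B_A$ and $\mathcal B_B$ be the sets of paths of $Q_A$ and $Q_B$ that contain no element of $Z_A$, respectively $Z_B$, as a subpath. Write $p\,\|\,q$ if the paths $p$ and $q$ have the same start and the same end, and write $X\|Y$ for the set of such pairs with $p\in X$, $q\in Y$. Let $$\delta_B^1: k((Q_B)_1\|\mathcal B_B)\to k(Z_B\|\mathcal B_B),\qquad a\|p\mapsto \sum_{r\in Z_B} r\,\|\,r^{a\|p},$$ where $r^{a\|p}$ is the sum of all paths in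 $\mathcal B_B$ obtained by replacing one appearance of the arrow $a$ in $r$ by the path $p$. A special pair is a pair $(a,p)$ of an arrow $a$ of $Q_A$ and a path $p\in\mathcal B_A$ such that (1) $a$ starts or ends at one of $e_1,e_2,e_{n-1},e_n$; (2) $a\nparallel p$ in $Q_A$; (3) $a^*\|p^*$ in $Q_B$, and $(a^*,p^*)\neq(\gamma^*,\gamma^*)$; (4) if $a=\alpha$ (resp. $a=\beta$), then $p\nparallel\beta$ (resp. $p\nparallel\alpha$); and if $p=\alpha$ (resp. $p=\beta$), then $a\nparallel\beta$ (resp. $a\nparallel\alpha$). Let $Z_{spp}(\alpha,\beta)$ be the intersection of $\mathrm{Ker}(\delta_B^1)$ with the subspace of $k((Q_B)_1\|\mathcal B_B)$ spanned by the elements $a^*\|p^*$ for all special pairs $(a,p)$. If $Z_{spp}(\alpha,\beta)=0$, then there is an isomorphism of Lie algebras over $k$ $$\mathrm{HH}^1(B)\simeq \mathrm{HH}^1(A)\times k .$$ Here $\mathrm{HH}^1$ of a $k$-algebra is the Lie algebra of its $k$-linear derivations (with the commutator bracket) modulo the inner derivations, and $k$ is the one-dimensional abelian Lie algebra. -/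

import Mathlib

open Quiver

attribute [local instance 100] LieRing.ofAssociativeRing

noncomputable section

namespace GluingArrows

universe u v w

/-! ## The path algebra of a quiver -/

section PathAlgebra

/-- A path of the quiver `V` together with its starting and ending vertex. -/
abbrev TPath (V : Type u) [Quiver.{v} V] : Type max u v := Σ x y : V, Path x y

/-- The trivial path at a vertex. -/
def vertexPath {V : Type u} [Quiver.{v} V] (x : V) : TPath V := ⟨x, x, Path.nil⟩

/-- An arrow, as a path of length one. -/
def arrowPath {V : Type u} [Quiver.{v} V] (a : Total V) : TPath V :=
  ⟨a.left, a.right, a.hom.toPath⟩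

/-- The path algebra `kV`: the `k`-vector space with basis the paths of `V`. -/
def PathAlgebra (k : Type w) [Field k] (V : Type u) [Quiver.{v} V] : Type max u v w :=
  TPath V →₀ k

variable (k : Type w) [Field k] {V : Type u} [Quiver.{v} V]

instance : AddCommGroup (PathAlgebra k V) := inferInstanceAs (AddCommGroup (TPath V →₀ k))

instance : Module k (PathAlgebra k V) := inferInstanceAs (Module k (TPath V →₀ k))

/-- A path, as a basis element of the path algebra. -/
def ofPath (p : TPath V) : PathAlgebra k V := Finsupp.single p (1 : k)

open Classical in
/-- The product `q p` of two paths, composed from right to left: first `p`, then `q`. It is zero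
if `p` does not end where `q` starts. -/
def pathMul (q p : TPath V) : PathAlgebra k V :=
  if h : p.2.1 = q.1 then ofPath k ⟨p.1, q.2.1, p.2.2.comp (q.2.2.cast h.symm rfl)⟩ else 0

/-- The linear extension to the path algebra of a function on paths. -/
def linExt {M : Type*} [AddCommGroup M] [Module k M] (f : TPath V → M) : PathAlgebra k V →ₗ[k] M :=
  Finsupp.linearCombination k f

theorem linExt_ofPath {M : Type*} [AddCommGroup M] [Module k M] (f : TPath V → M) (p : TPath V) :
    linExt k f (ofPath k p) = f p :=
  (Finsupp.linearCombination_single k 1 p).trans (one_smul k (f p))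

/-- The bilinear extension of `pathMul`. -/
def mulLin : PathAlgebra k V →ₗ[k] PathAlgebra k V →ₗ[k] PathAlgebra k V :=
  linExt k fun q => linExt k fun p => pathMul k q p

instance : Mul (PathAlgebra k V) := ⟨fun x y => mulLin k x y⟩

instance [Fintype V] : One (PathAlgebra k V) := ⟨∑ x : V, ofPath k (vertexPath x)⟩

variable {k}

theorem mul_def (x y : PathAlgebra k V) : x * y = mulLin k x y := rfl

theorem mulLin_ofPath (q p : TPath V) : mulLin k (ofPath k q) (ofPath k p) = pathMul k q p := by
  rw [mulLin, linExt_ofPath, linExt_ofPath]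

theorem hom_ext {M : Type*} [AddCommGroup M] [Module k M] {f g : PathAlgebra k V →ₗ[k] M}
    (h : ∀ p, f (ofPath k p) = g (ofPath k p)) : f = g :=
  Finsupp.lhom_ext' fun p => LinearMap.ext_ring (h p)

theorem pathMul_of_comp {x y z : V} (q : Path y z) (p : Path x y) :
    pathMul k ⟨y, z, q⟩ ⟨x, y, p⟩ = ofPath k ⟨x, z, p.comp q⟩ := by
  simp [pathMul]

theorem pathMul_of_ne {q p : TPath V} (h : p.2.1 ≠ q.1) : pathMul k q p = 0 := by
  simp [pathMul, h]

theorem mulLin_assoc (x y z : PathAlgebra k V) :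
    mulLin k (mulLin k x y) z = mulLin k x (mulLin k y z) := by
  have key : ∀ r q p : TPath V, mulLin k (mulLin k (ofPath k r) (ofPath k q)) (ofPath k p) =
      mulLin k (ofPath k r) (mulLin k (ofPath k q) (ofPath k p)) := by
    rintro ⟨a, b, r⟩ ⟨c, d, q⟩ ⟨e, f, p⟩
    rw [mulLin_ofPath, mulLin_ofPath]
    by_cases h1 : d = a
    · subst h1
      rw [pathMul_of_comp, mulLin_ofPath]
      by_cases h2 : f = c
      · subst h2
        rw [pathMul_of_comp, pathMul_of_comp, mulLin_ofPath, pathMul_of_comp, Path.comp_assoc]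
      · rw [pathMul_of_ne (by simpa using h2), pathMul_of_ne (by simpa using h2), map_zero]
    · rw [pathMul_of_ne (by simpa using h1), map_zero, LinearMap.zero_apply]
      by_cases h2 : f = c
      · subst h2
        rw [pathMul_of_comp, mulLin_ofPath, pathMul_of_ne (by simpa using h1)]
      · rw [pathMul_of_ne (p := ⟨e, f, p⟩) (by simpa using h2), map_zero]
  have e1 : (LinearMap.llcomp k _ _ _ (mulLin k (V := V))).comp (mulLin k (V := V)) =
      ((LinearMap.llcomp k (PathAlgebra k V) (PathAlgebra k V) (PathAlgebra k V)).flip.comp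
        (mulLin k (V := V))).flip.comp (mulLin k (V := V)) := by
    refine hom_ext fun r => hom_ext fun q => hom_ext fun p => ?_
    simpa using key r q p
  have := LinearMap.congr_fun (LinearMap.congr_fun (LinearMap.congr_fun e1 x) y) z
  simpa using this

theorem one_mulLin [Fintype V] (x : PathAlgebra k V) :
    mulLin k (∑ v : V, ofPath k (vertexPath v)) x = x := by
  have : mulLin k (∑ v : V, ofPath k (vertexPath v)) = LinearMap.id := by
    refine hom_ext ?_
    rintro ⟨a, b, p⟩
    rw [map_sum, LinearMap.sum_apply, Finset.sum_eq_single b]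
    · rw [mulLin_ofPath, vertexPath, pathMul_of_comp]; rfl
    · intro c _ hc
      rw [mulLin_ofPath, pathMul_of_ne (by simpa [vertexPath] using hc.symm)]
    · simp
  rw [this]; rfl

theorem mulLin_one [Fintype V] (x : PathAlgebra k V) :
    mulLin k x (∑ v : V, ofPath k (vertexPath v)) = x := by
  have : (mulLin k).flip (∑ v : V, ofPath k (vertexPath v)) = LinearMap.id := by
    refine hom_ext ?_
    rintro ⟨a, b, p⟩
    rw [map_sum, LinearMap.sum_apply, Finset.sum_eq_single a]
    · rw [LinearMap.flip_apply, mulLin_ofPath, vertexPath, pathMul_of_comp, Path.nil_comp]; rfl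
    · intro c _ hc
      rw [LinearMap.flip_apply, mulLin_ofPath, pathMul_of_ne (by simpa [vertexPath] using hc)]
    · simp
  exact LinearMap.congr_fun this x

instance [Fintype V] : Ring (PathAlgebra k V) where
  __ := (inferInstance : AddCommGroup (PathAlgebra k V))
  __ := (inferInstance : Mul (PathAlgebra k V))
  __ := (inferInstance : One (PathAlgebra k V))
  left_distrib x y z := map_add (mulLin k x) y z
  right_distrib x y z := by simp [mul_def]
  zero_mul x := by simp [mul_def]
  mul_zero x := by simp [mul_def]
  mul_assoc := mulLin_assoc
  one_mul := one_mulLin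
  mul_one := mulLin_one

instance [Fintype V] : Algebra k (PathAlgebra k V) :=
  Algebra.ofModule (fun r x y => by simp [mul_def]) (fun r x y => by simp [mul_def])

variable (k V) in
/-- The `m`-th power of the arrow ideal of `kV`: the span of the paths of length at least `m`. -/
def arrowIdealPow (m : ℕ) : Submodule k (PathAlgebra k V) :=
  Submodule.span k {x | ∃ p : TPath V, m ≤ p.2.2.length ∧ x = ofPath k p}

/-- An ideal `I` of `kV` is admissible if `J ^ N ⊆ I ⊆ J ^ 2` for some `N ≥ 2`, where `J` is the
arrow ideal. -/
def IsAdmissible [Fintype V] (I : Ideal (PathAlgebra k V)) : Prop :=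
  (∃ N, 2 ≤ N ∧ ∀ x ∈ arrowIdealPow k V N, x ∈ I) ∧ ∀ x ∈ I, x ∈ arrowIdealPow k V 2

end PathAlgebra

/-! ## First Hochschild cohomology, radical square zero algebras, blocks -/

section Algebras

variable (k : Type u) [Field k] (A : Type v) [Ring A] [Algebra k A]

/-- The Lie algebra of `k`-linear derivations `A → A`, with the commutator bracket. -/
def derivations : LieSubalgebra k (Module.End k A) where
  carrier := {D | ∀ x y : A, D (x * y) = D x * y + x * D y}
  add_mem' := by
    intro D E (hD : ∀ x y, _) (hE : ∀ x y, _) x y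
    simp only [LinearMap.add_apply, hD, hE]
    noncomm_ring
  zero_mem' := by intro x y; simp
  smul_mem' := by
    intro c D (hD : ∀ x y, _) x y
    simp [hD]
  lie_mem' := by
    intro D E (hD : ∀ x y, D (x * y) = D x * y + x * D y)
      (hE : ∀ x y, E (x * y) = E x * y + x * E y) x y
    simp only [Ring.lie_def, LinearMap.sub_apply, Module.End.mul_apply, hD, hE, map_add]
    noncomm_ring

/-- The Lie ideal of inner derivations `y ↦ x y - y x`. -/
def innerDerivations : LieIdeal k (derivations k A) where
  carrier := {D | ∃ x : A, ∀ y : A, D.1 y = x * y - y * x}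
  add_mem' := by
    rintro D E ⟨x, hx⟩ ⟨y, hy⟩
    refine ⟨x + y, fun z => ?_⟩
    change D.1 z + E.1 z = _
    rw [hx, hy]
    noncomm_ring
  zero_mem' := ⟨0, fun y => by simp⟩
  smul_mem' := by
    rintro c D ⟨x, hx⟩
    refine ⟨c • x, fun z => ?_⟩
    simp [hx, smul_sub]
  lie_mem := by
    rintro D E ⟨x, hx⟩
    refine ⟨D.1 x, fun z => ?_⟩
    have h : ∀ a b : A, D.1 (a * b) = D.1 a * b + a * D.1 b := D.2
    simp only [LieSubalgebra.coe_bracket, Ring.lie_def, LinearMap.sub_apply,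
      Module.End.mul_apply, hx, map_sub, h]
    noncomm_ring

/-- The Lie algebra `HH¹(A)`: derivations modulo inner derivations. -/
abbrev HH1 : Type v := derivations k A ⧸ innerDerivations k A

variable {A}

/-- The square of the Jacobson radical of `A` is zero. -/
def IsRadicalSquareZero (A : Type v) [Ring A] : Prop :=
  ∀ x ∈ Ring.jacobson A, ∀ y ∈ Ring.jacobson A, x * y = 0

/-- `c` is a central idempotent of `A`. -/
def IsCentralIdempotent (c : A) : Prop := c * c = c ∧ ∀ x : A, c * x = x * c

/-- `c` is a block idempotent of `A`, that is, a primitive central idempotent; the corresponding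
block is `c A`. -/
def IsBlockIdempotent (c : A) : Prop :=
  IsCentralIdempotent c ∧ c ≠ 0 ∧ ∀ c₁ c₂ : A, IsCentralIdempotent c₁ → IsCentralIdempotent c₂ →
    c₁ * c₂ = 0 → c₁ + c₂ = c → c₁ = 0 ∨ c₂ = 0

/-- `x` and `y` lie in the same block of `A`. -/
def SameBlock (x y : A) : Prop := ∃ c : A, IsBlockIdempotent c ∧ c * x = x ∧ c * y = y

end Algebras

/-! ## Parallel paths and the first differential -/

section Monomial

variable {V : Type u} [Quiver.{v} V]

/-- `z` is a subpath of `p`. -/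
def IsSubpath (z p : TPath V) : Prop :=
  ∃ (s : Path p.1 z.1) (t : Path z.2.1 p.2.1), p.2.2 = s.comp (z.2.2.comp t)

/-- The elements of `S` which have no proper subpath in `S`. -/
def minimalPaths (S : Set (TPath V)) : Set (TPath V) :=
  {p | p ∈ S ∧ ∀ z ∈ S, IsSubpath z p → z = p}

/-- The set of paths which do not contain any element of `Z` as a subpath. -/
def basisPaths (Z : Set (TPath V)) : Set (TPath V) := {p | ∀ z ∈ Z, ¬ IsSubpath z p}

/-- The minimal set `Z` of paths generating a monomial ideal `I` of the path algebra. -/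
def monomialRelations {k : Type w} [Field k] [Fintype V] (I : Ideal (PathAlgebra k V)) :
    Set (TPath V) :=
  minimalPaths {p | ofPath k p ∈ I}

/-- Two paths with the same starting vertex and the same ending vertex. -/
def Parallel (p q : TPath V) : Prop := p.1 = q.1 ∧ p.2.1 = q.2.1

/-- The set `X ∥ Y` of pairs of parallel paths, the first in `X` and the second in `Y`. -/
structure ParallelPair (X Y : Set (TPath V)) where
  {src : V}
  {tgt : V}
  fst : Path src tgt
  snd : Path src tgt
  fst_mem : (⟨src, tgt, fst⟩ : TPath V) ∈ X
  snd_mem : (⟨src, tgt, snd⟩ : TPath V) ∈ Y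

/-- The set of arrows, as paths of length one. -/
def arrowPaths (V : Type u) [Quiver.{v} V] : Set (TPath V) := Set.range arrowPath

/-- The number of ways in which `q` is obtained by replacing one appearance of `a` in `r` by `p`
(this is finite, as `r` has finitely many subpaths). It is the coefficient of `q` in
`r ^ (a ∥ p)`. -/
def replaceCount {x y s t : V} (a p : Path x y) (r q : Path s t) : ℕ :=
  Nat.card {c : Path s x × Path y t //
    c.1.comp (a.comp c.2) = r ∧ c.1.comp (p.comp c.2) = q}

/-- The differential `δ¹ : k(Q₁ ∥ 𝓑) → k(Z ∥ 𝓑)`, `a ∥ p ↦ ∑_{r ∈ Z} r ∥ r ^ (a ∥ p)`, with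
`𝓑 = basisPaths Z`. An element of the target is given by its coefficients. -/
def delta1 (k : Type w) [Field k] (Z : Set (TPath V)) :
    (ParallelPair (arrowPaths V) (basisPaths Z) →₀ k) →ₗ[k]
      (ParallelPair Z (basisPaths Z) → k) :=
  Finsupp.linearCombination k fun c d => (replaceCount c.fst c.snd d.fst d.snd : k)

/-- The list of arrows of a path, in the order in which the path runs through them. -/
def arrowList {x : V} : ∀ {y : V}, Path x y → List (Total V)
  | _, Path.nil => []
  | _, Path.cons p a => arrowList p ++ [⟨_, _, a⟩]

end Monomial

/-! ## Gluing two arrows -/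

section Gluing

variable {V : Type u} [Quiver.{v} V]

/-- The vertices of `Q_B`: the starting vertices of `α` and `β` are identified, and so are their
ending vertices. -/
def GluedVertex (α β : Total V) : Type u :=
  Quot fun x y : V => (x = α.left ∧ y = β.left) ∨ (x = α.right ∧ y = β.right)

/-- The arrows of `Q_B`: the arrows `α` and `β` are identified. -/
def GluedArrow (α β : Total V) : Type max u v := Quot fun a b : Total V => a = α ∧ b = β

/-- The starting vertex of an arrow of `Q_B`. -/
def GluedArrow.source {α β : Total V} : GluedArrow α β → GluedVertex α β :=
  Quot.lift (fun a => Quot.mk _ a.left) (by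
    rintro a b ⟨rfl, rfl⟩; exact Quot.sound (Or.inl ⟨rfl, rfl⟩))

/-- The ending vertex of an arrow of `Q_B`. -/
def GluedArrow.target {α β : Total V} : GluedArrow α β → GluedVertex α β :=
  Quot.lift (fun a => Quot.mk _ a.right) (by
    rintro a b ⟨rfl, rfl⟩; exact Quot.sound (Or.inr ⟨rfl, rfl⟩))

/-- The quiver `Q_B` obtained from `Q_A` by gluing the arrows `α` and `β`. -/
instance (α β : Total V) : Quiver.{max u v} (GluedVertex α β) where
  Hom x y := {b : GluedArrow α β // b.source = x ∧ b.target = y}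

/-- The quiver morphism `φ : Q_A → Q_B`. -/
def glueMap (α β : Total V) : V ⥤q GluedVertex α β where
  obj x := Quot.mk _ x
  map a := ⟨Quot.mk _ ⟨_, _, a⟩, rfl, rfl⟩

/-- The arrow `a*` of `Q_B` given by an arrow `a` of `Q_A`; so `α* = β* = γ*`. -/
def starArrow (α β : Total V) (a : Total V) : Total (GluedVertex α β) :=
  ⟨_, _, (glueMap α β).map a.hom⟩

/-- The path `p*` of `Q_B` given by a path `p` of `Q_A`. -/
def starPath (α β : Total V) (p : TPath V) : TPath (GluedVertex α β) :=
  ⟨_, _, (glueMap α β).mapPath p.2.2⟩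

/-- The newly formed paths of `Q_B` which come in along `σ` and leave along `τ`, where `(σ, τ)` is
`(α, β)` or `(β, α)`: the paths of length two through a glued vertex and those of length three
through `γ*`. -/
def newPathsAlong (α β σ τ : Total V) : Set (TPath (GluedVertex α β)) :=
  {p | (∃ η l : Total V, η.right = σ.left ∧ l.left = τ.left ∧ l ≠ τ ∧
          arrowList p.2.2 = [starArrow α β η, starArrow α β l]) ∨
       (∃ μ ξ : Total V, μ.right = σ.right ∧ μ ≠ σ ∧ ξ.left = τ.right ∧
          arrowList p.2.2 = [starArrow α β μ, starArrow α β ξ]) ∨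
       (∃ η ξ : Total V, η.right = σ.left ∧ ξ.left = τ.right ∧
          arrowList p.2.2 = [starArrow α β η, starArrow α β α, starArrow α β ξ])}

/-- The set `Z_new` of newly formed paths. -/
def newPaths (α β : Total V) : Set (TPath (GluedVertex α β)) :=
  newPathsAlong α β α β ∪ newPathsAlong α β β α

/-- The minimal set `Z_B` of paths generating `I_B`, the ideal generated by `Z_A` and `Z_new`. -/
def gluedRelations (Z : Set (TPath V)) (α β : Total V) : Set (TPath (GluedVertex α β)) :=
  minimalPaths (starPath α β '' Z ∪ newPaths α β)

/-- `(a, p)` is a special pair with respect to the gluing of `α` and `β`, where `A` is the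
monomial algebra given by `Z`. -/
structure IsSpecialPair (Z : Set (TPath V)) (α β : Total V) (a : Total V) (p : TPath V) :
    Prop where
  mem : p ∈ basisPaths Z
  touches : (a.left ∈ ({α.left, α.right, β.left, β.right} : Set V)) ∨
    (a.right ∈ ({α.left, α.right, β.left, β.right} : Set V))
  not_parallel : ¬ Parallel (arrowPath a) p
  star_parallel : Parallel (arrowPath (starArrow α β a)) (starPath α β p)
  star_ne : ¬ (starArrow α β a = starArrow α β α ∧ starPath α β p = starPath α β (arrowPath α))
  of_eq_left : a = α → ¬ Parallel p (arrowPath β)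
  of_eq_right : a = β → ¬ Parallel p (arrowPath α)
  of_path_eq_left : p = arrowPath α → ¬ Parallel (arrowPath a) (arrowPath β)
  of_path_eq_right : p = arrowPath β → ¬ Parallel (arrowPath a) (arrowPath α)

/-- The subspace `⟨Spp(α, β)⟩` of `k((Q_B)₁ ∥ 𝓑_B)` spanned by the elements `a* ∥ p*` for the
special pairs `(a, p)`. -/
def specialPairSpan (k : Type w) [Field k] (Z : Set (TPath V)) (α β : Total V) :
    Submodule k (ParallelPair (arrowPaths (GluedVertex α β))
      (basisPaths (gluedRelations Z α β)) →₀ k) :=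
  Submodule.span k {x | ∃ (a : Total V) (p : TPath V)
    (c : ParallelPair (arrowPaths (GluedVertex α β)) (basisPaths (gluedRelations Z α β))),
    IsSpecialPair Z α β a p ∧
    (⟨c.src, c.tgt, c.fst⟩ : TPath _) = arrowPath (starArrow α β a) ∧
    (⟨c.src, c.tgt, c.snd⟩ : TPath _) = starPath α β p ∧
    x = Finsupp.single c 1}

/-- `Z_spp(α, β)`, the intersection of `⟨Spp(α, β)⟩` with the kernel of `δ¹` of `B`. -/
def Zspp (k : Type w) [Field k] (Z : Set (TPath V)) (α β : Total V) :
    Submodule k (ParallelPair (arrowPaths (GluedVertex α β))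
      (basisPaths (gluedRelations Z α β)) →₀ k) :=
  specialPairSpan k Z α β ⊓ LinearMap.ker (delta1 k (gluedRelations Z α β))

variable {k : Type w} [Field k] [Fintype V]

/-- The idempotent of `A = kQ_A / I` at a vertex. -/
def vertexElem (I : Ideal (PathAlgebra k V)) [I.IsTwoSided] (x : V) : PathAlgebra k V ⧸ I :=
  Ideal.Quotient.mk I (ofPath k (vertexPath x))

/-- The element of `A = kQ_A / I` given by an arrow. -/
def arrowElem (I : Ideal (PathAlgebra k V)) [I.IsTwoSided] (a : Total V) : PathAlgebra k V ⧸ I :=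
  Ideal.Quotient.mk I (ofPath k (arrowPath a))

/-- The algebra `B` obtained from `A = kQ_A / I` by gluing the arrows `α` and `β`: the subalgebra
of `A` generated by the sum of the idempotents at the starting vertices of `α` and `β`, the sum of
the idempotents at their ending vertices, the idempotents at the other vertices, the element
`α + β` and the other arrows. -/
def gluedAlgebra (I : Ideal (PathAlgebra k V)) [I.IsTwoSided] (α β : Total V) :
    Subalgebra k (PathAlgebra k V ⧸ I) :=
  Algebra.adjoin k
    ({vertexElem I α.left + vertexElem I β.left, vertexElem I α.right + vertexElem I β.right,
      arrowElem I α + arrowElem I β} ∪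
      {x | ∃ y : V, y ∉ ({α.left, α.right, β.left, β.right} : Set V) ∧ x = vertexElem I y} ∪
      {x | ∃ a : Total V, a ≠ α ∧ a ≠ β ∧ x = arrowElem I a})

end Gluing

end GluingArrows

end

/-! Admissibility together with radical square zero forces the ideal of relations to be the square
of the arrow ideal, so `A` has the vertices and arrows as a basis and any two arrows multiply to
zero. The subalgebra `B` is of the same kind: sums of basis elements over the fibres of the gluing
map form such a basis for the glued quiver.

For any such algebra in characteristic zero, a derivation preserves the span of the arrows and acts
there by a matrix that is block diagonal along the classes of parallel arrows. Every such matrix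
occurs, and the inner derivations are exactly those acting by `diag (f (t a) - f (s a))` for a
function `f` on the vertices. Block diagonal matrices split into traceless blocks and central block
scalars, so `HH¹` is the traceless part times an abelian algebra of dimension (number of parallel
classes) - (rank of `vertexDiff`); this is `IsQuiverBasis.nonempty_HH1_equiv`.

It remains to compare the two quivers. All paths of length two are relations of `B`, so `δ¹` kills
every pair of an arrow and an arrow; hence `Z_spp = 0` rules out special pairs of arrows.
Consequently arrows become parallel under the gluing only if they were parallel already, or one of
them is `α` or `β` and the other is parallel to the other glued arrow. So at most one of `α`, `β`
has a parallel companion; by symmetry let `α` have none. Then `Q_A` has the classes of `Q_B` plus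
the singleton `{α}`, whose traceless block is zero. The kernel of `vertexDiff` does not change,
because functions constant along arrows agree on `α` and `β` when these lie in one block. With two
more vertices the rank for `A` is larger by two, while the number of classes is larger by one:
`HH¹(B)` gains exactly one abelian dimension (`IsQuiverBasis.nonempty_HH1_equiv_prod`). -/

noncomputable section

namespace GluingArrows

universe u v w

/-! ### Derivations of an algebra with a quiver basis -/

section QuiverBasis

/-- `b` is a basis of `R` consisting of the vertices and the arrows of a quiver with vertex set `V`
and arrow set `E`, multiplied as in the path algebra modulo the paths of length two. -/
structure IsQuiverBasis {k : Type*} [Field k] {R : Type*} [Ring R] [Algebra k R] {V E : Type*}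
    [Fintype V] [DecidableEq V] (s t : E → V) (b : Module.Basis (V ⊕ E) k R) : Prop where
  vertex_mul_vertex : ∀ x y, b (.inl x) * b (.inl y) = if x = y then b (.inl x) else 0
  vertex_mul_arrow : ∀ x a, b (.inl x) * b (.inr a) = if t a = x then b (.inr a) else 0
  arrow_mul_vertex : ∀ a x, b (.inr a) * b (.inl x) = if s a = x then b (.inr a) else 0
  arrow_mul_arrow : ∀ a a', b (.inr a) * b (.inr a') = 0
  sum_vertex : ∑ x, b (.inl x) = 1

namespace IsQuiverBasis

variable {k : Type u} [Field k] {R : Type v} [Ring R] [Algebra k R] {V E : Type*} [Fintype V]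
  [DecidableEq V] {s t : E → V} {b : Module.Basis (V ⊕ E) k R}

/-- Arrows annihilate each other, so an arrow only sees the coefficient of `r` at its starting
vertex. -/
theorem arrow_mul (h : IsQuiverBasis s t b) (a : E) (r : R) :
    b (.inr a) * r = b.coord (.inl (s a)) r • b (.inr a) := by
  have : LinearMap.mulLeft k (b (.inr a)) =
      (b.coord (.inl (s a))).smulRight (b (.inr a)) := by
    refine b.ext ?_
    rintro (x | a')
    · rw [LinearMap.mulLeft_apply, h.arrow_mul_vertex]
      by_cases hx : s a = x
      · simp [hx]
      · simp [hx]
    · simp [h.arrow_mul_arrow]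
  exact LinearMap.congr_fun this r

theorem mul_arrow (h : IsQuiverBasis s t b) (a : E) (r : R) :
    r * b (.inr a) = b.coord (.inl (t a)) r • b (.inr a) := by
  have : LinearMap.mulRight k (b (.inr a)) =
      (b.coord (.inl (t a))).smulRight (b (.inr a)) := by
    refine b.ext ?_
    rintro (x | a')
    · rw [LinearMap.mulRight_apply, h.vertex_mul_arrow]
      by_cases hx : t a = x
      · simp [hx]
      · simp [hx]
    · simp [h.arrow_mul_arrow]
  exact LinearMap.congr_fun this r

/-- Left multiplication by a vertex is a Peirce projection; `Sum.elim id t` treats a vertex as its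
own end. -/
theorem coord_vertex_mul (h : IsQuiverBasis s t b) (x : V) (r : R) (i : V ⊕ E) :
    b.coord i (b (.inl x) * r) = if Sum.elim id t i = x then b.coord i r else 0 := by
  classical
  have key : ∀ j, b.coord i (b (.inl x) * b j) =
      (if Sum.elim id t i = x then 1 else 0) * b.coord i (b j) := by
    rintro (y | a)
    · rw [h.vertex_mul_vertex]
      rcases i with z | a'
      · by_cases hxy : x = y <;> by_cases hz : y = z <;> simp_all [eq_comm]
      · by_cases hxy : x = y <;> simp_all [eq_comm]
    · rw [h.vertex_mul_arrow]
      rcases i with z | a'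
      · by_cases hxy : t a = x <;> simp_all [eq_comm]
      · by_cases hxy : t a = x <;> by_cases ha : a = a' <;> simp_all [eq_comm]
  have := LinearMap.congr_fun (b.ext key : b.coord i ∘ₗ LinearMap.mulLeft k (b (.inl x)) =
    LinearMap.mulLeft k (if Sum.elim id t i = x then 1 else 0) ∘ₗ b.coord i) r
  simpa using this

theorem coord_mul_vertex (h : IsQuiverBasis s t b) (x : V) (r : R) (i : V ⊕ E) :
    b.coord i (r * b (.inl x)) = if Sum.elim id s i = x then b.coord i r else 0 := by
  classical
  have key : ∀ j, b.coord i (b j * b (.inl x)) =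
      (if Sum.elim id s i = x then 1 else 0) * b.coord i (b j) := by
    rintro (y | a)
    · rw [h.vertex_mul_vertex]
      rcases i with z | a'
      · by_cases hxy : y = x <;> by_cases hz : y = z <;> simp_all [eq_comm]
      · by_cases hxy : y = x <;> simp_all [eq_comm]
    · rw [h.arrow_mul_vertex]
      rcases i with z | a'
      · by_cases hxy : s a = x <;> simp_all [eq_comm]
      · by_cases hxy : s a = x <;> by_cases ha : a = a' <;> simp_all [eq_comm]
  have := LinearMap.congr_fun (b.ext key : b.coord i ∘ₗ LinearMap.mulRight k (b (.inl x)) =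
    LinearMap.mulLeft k (if Sum.elim id s i = x then 1 else 0) ∘ₗ b.coord i) r
  simpa using this

variable {D : Module.End k R}

/-- In `D e = D e * e + e * D e` the coefficient `c` at `e` satisfies `c = c + c`, and the
coefficient at any other vertex is killed on the right. Thus `D e` lies in the span of the arrows.
-/
theorem coord_derivation_vertex (h : IsQuiverBasis s t b) (hD : D ∈ derivations k R) (x y : V) :
    b.coord (.inl y) (D (b (.inl x))) = 0 := by
  have h1 : D (b (.inl x)) = D (b (.inl x)) * b (.inl x) + b (.inl x) * D (b (.inl x)) := by
    conv_lhs => rw [← if_pos (rfl : x = x) (α := R) (t := b (.inl x)) (e := 0),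
      ← h.vertex_mul_vertex x x, hD]
  have h2 := congrArg (b.coord (.inl y)) h1
  rw [map_add, h.coord_mul_vertex, h.coord_vertex_mul] at h2
  by_cases hy : y = x
  · subst hy
    simpa using h2
  · simpa [hy] using h2

theorem derivation_arrow_eq_left (h : IsQuiverBasis s t b) (hD : D ∈ derivations k R) (a : E) :
    D (b (.inr a)) = b (.inl (t a)) * D (b (.inr a)) := by
  have h1 := hD (b (.inl (t a))) (b (.inr a))
  rwa [h.mul_arrow a (D _), h.coord_derivation_vertex hD, zero_smul, zero_add,
    h.vertex_mul_arrow, if_pos rfl] at h1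

theorem derivation_arrow_eq_right (h : IsQuiverBasis s t b) (hD : D ∈ derivations k R) (a : E) :
    D (b (.inr a)) = D (b (.inr a)) * b (.inl (s a)) := by
  have h1 := hD (b (.inr a)) (b (.inl (s a)))
  rwa [h.arrow_mul a (D _), h.coord_derivation_vertex hD, zero_smul, add_zero,
    h.arrow_mul_vertex, if_pos rfl] at h1

theorem coord_derivation_arrow (h : IsQuiverBasis s t b) (hD : D ∈ derivations k R) (a : E)
    {i : V ⊕ E} (hi : ¬ (Sum.elim id s i = s a ∧ Sum.elim id t i = t a)) :
    b.coord i (D (b (.inr a))) = 0 := by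
  by_cases h1 : Sum.elim id s i = s a
  · rw [h.derivation_arrow_eq_left hD, h.coord_vertex_mul, if_neg fun h2 => hi ⟨h1, h2⟩]
  · rw [h.derivation_arrow_eq_right hD, h.coord_mul_vertex, if_neg h1]

/-- Only a loop could acquire a vertex component `c`. Deriving `a * a = 0` gives `2 c a = 0`, and
`2` is invertible in characteristic zero. -/
theorem coord_vertex_derivation_arrow [CharZero k] (h : IsQuiverBasis s t b)
    (hD : D ∈ derivations k R) (a : E) (x : V) : b.coord (.inl x) (D (b (.inr a))) = 0 := by
  by_cases hx : x = s a ∧ x = t a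
  · have h1 := hD (b (.inr a)) (b (.inr a))
    rw [h.arrow_mul_arrow, map_zero, h.mul_arrow, h.arrow_mul, ← add_smul, ← hx.1, ← hx.2] at h1
    have h2 := (smul_eq_zero.1 h1.symm).resolve_right (b.ne_zero _)
    rwa [← two_mul, mul_eq_zero, or_iff_right two_ne_zero] at h2
  · exact h.coord_derivation_arrow hD a hx

variable [Fintype E]

theorem derivation_arrow [CharZero k] (h : IsQuiverBasis s t b) (hD : D ∈ derivations k R)
    (a : E) : D (b (.inr a)) = ∑ a', b.coord (.inr a') (D (b (.inr a))) • b (.inr a') := by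
  conv_lhs => rw [← b.sum_repr (D (b (.inr a)))]
  rw [Fintype.sum_sum_type]
  simp_rw [← b.coord_apply, h.coord_vertex_derivation_arrow hD]
  simp

variable [DecidableEq E]

/-- The action of the derivations on the radical, as matrices with respect to the arrows. -/
def arrowMatrix [CharZero k] (h : IsQuiverBasis s t b) : derivations k R →ₗ⁅k⁆ Matrix E E k where
  toFun D := Matrix.of fun a' a => b.coord (.inr a') (D.1 (b (.inr a)))
  map_add' D D' := by ext; simp
  map_smul' c D := by ext; simp
  map_lie' := by
    -- The span of the arrows is stable under derivations, so composition becomes the matrix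
    -- product.
    have key : ∀ D D' : derivations k R, ∀ a' a,
        b.coord (.inr a') (D.1 (D'.1 (b (.inr a)))) =
        ∑ c, b.coord (.inr a') (D.1 (b (.inr c))) * b.coord (.inr c) (D'.1 (b (.inr a))) := by
      intro D D' a' a
      rw [h.derivation_arrow D'.2 a, map_sum, map_sum]
      refine Finset.sum_congr rfl fun c _ => ?_
      rw [map_smul, map_smul, smul_eq_mul, mul_comm, ← h.derivation_arrow D'.2 a]
    intro D D'
    ext a' a
    simp only [LieSubalgebra.coe_bracket, Ring.lie_def, LinearMap.sub_apply,
      Module.End.mul_apply, map_sub, Matrix.of_apply, Matrix.sub_apply, Matrix.mul_apply, key]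

theorem arrowMatrix_apply [CharZero k] (h : IsQuiverBasis s t b) (D : derivations k R) (a' a : E) :
    h.arrowMatrix D a' a = b.coord (.inr a') (D.1 (b (.inr a))) := rfl

theorem arrowMatrix_eq_zero [CharZero k] (h : IsQuiverBasis s t b) (D : derivations k R) {a' a : E}
    (ha : (s a', t a') ≠ (s a, t a)) : h.arrowMatrix D a' a = 0 :=
  h.coord_derivation_arrow D.2 a fun hi => ha (Prod.ext_iff.2 hi)

/-- The derivation is taken to vanish on the vertices. The Leibniz rule, checked on basis pairs,
needs only that `M` preserves both ends of an arrow. -/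
theorem exists_arrowMatrix_eq [CharZero k] (h : IsQuiverBasis s t b) (M : Matrix E E k)
    (hM : ∀ a' a, (s a', t a') ≠ (s a, t a) → M a' a = 0) :
    ∃ D : derivations k R, h.arrowMatrix D = M := by
  classical
  let D : Module.End k R := b.constr k (Sum.elim 0 fun a => ∑ a', M a' a • b (.inr a'))
  have hx : ∀ x, D (b (.inl x)) = 0 := fun x => by simp [D, b.constr_basis]
  have ha : ∀ a, D (b (.inr a)) = ∑ a', M a' a • b (.inr a') :=
    fun a => by simp [D, b.constr_basis]
  have hD : D ∈ derivations k R := by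
    have h1 : (LinearMap.mul k R).compr₂ D =
        (LinearMap.mul k R) ∘ₗ D + (LinearMap.mul k R).compl₂ D := by
      refine b.ext fun i => b.ext fun j => ?_
      simp only [LinearMap.compr₂_apply, LinearMap.add_apply, LinearMap.comp_apply,
        LinearMap.compl₂_apply, LinearMap.mul_apply']
      rcases i with x | a <;> rcases j with y | a'
      · rw [h.vertex_mul_vertex, hx, hx, zero_mul, mul_zero, add_zero]
        split_ifs <;> simp [hx]
      · rw [h.vertex_mul_arrow, hx, zero_mul, zero_add, apply_ite D, map_zero, ha, Finset.mul_sum,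
          ← Finset.sum_const_zero (s := (Finset.univ : Finset E)), ← Finset.sum_ite_irrel]
        refine Finset.sum_congr rfl fun c _ => ?_
        rw [mul_smul_comm, h.vertex_mul_arrow]
        by_cases hc : (s c, t c) = (s a', t a')
        · rw [show t c = t a' from (Prod.ext_iff.1 hc).2]; split_ifs <;> simp
        · simp [hM c a' hc]
      · rw [h.arrow_mul_vertex, hx, mul_zero, add_zero, apply_ite D, map_zero, ha, Finset.sum_mul,
          ← Finset.sum_const_zero (s := (Finset.univ : Finset E)), ← Finset.sum_ite_irrel]
        refine Finset.sum_congr rfl fun c _ => ?_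
        rw [smul_mul_assoc, h.arrow_mul_vertex]
        by_cases hc : (s c, t c) = (s a, t a)
        · rw [show s c = s a from (Prod.ext_iff.1 hc).1]; split_ifs <;> simp
        · simp [hM c a hc]
      · simp [ha, h.arrow_mul_arrow, Finset.sum_mul, Finset.mul_sum]
    intro x y
    simpa using LinearMap.congr_fun (LinearMap.congr_fun h1 x) y
  refine ⟨⟨D, hD⟩, ?_⟩
  ext a' a
  rw [arrowMatrix_apply]
  simp [ha, Finsupp.single_apply]

theorem mem_innerDerivations_iff [CharZero k] (h : IsQuiverBasis s t b)
    (D : derivations k R) : D ∈ innerDerivations k R ↔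
      ∃ f : V → k, h.arrowMatrix D = Matrix.diagonal fun a => f (t a) - f (s a) := by
  have ad : ∀ (r : R) (a : E), r * b (.inr a) - b (.inr a) * r =
      (b.coord (.inl (t a)) r - b.coord (.inl (s a)) r) • b (.inr a) := fun r a => by
    rw [h.mul_arrow, h.arrow_mul, sub_smul]
  constructor
  · rintro ⟨r, hr⟩
    refine ⟨fun x => b.coord (.inl x) r, ?_⟩
    ext a' a
    rw [arrowMatrix_apply, hr, ad, Matrix.diagonal_apply, map_smul, b.coord_apply (.inr a'),
      b.repr_self, Finsupp.single_apply]
    by_cases haa : a' = a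
    · subst haa; simp
    · simp [haa, Ne.symm haa]
  · rintro ⟨f, hf⟩
    have hD : ∀ x y : R, D.1 (x * y) = D.1 x * y + x * D.1 y := D.2
    -- The implementing element is `r + z`: the commutator with `r` gives `D` on vertices and
    -- vanishes on arrows, that with `z` vanishes on vertices and gives the prescribed diagonal
    -- action on arrows.
    let r := ∑ x, D.1 (b (.inl x)) * b (.inl x)
    let z := ∑ x, f x • b (.inl x)
    have hr : ∀ x, b.coord (.inl x) r = 0 := fun x => by
      simp only [r, map_sum, h.coord_mul_vertex, h.coord_derivation_vertex D.2, ite_self,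
        Finset.sum_const_zero]
    have hz : ∀ x, b.coord (.inl x) z = f x := fun x => by
      simp [z, Finsupp.single_apply]
    refine ⟨r + z, fun y => ?_⟩
    suffices D.1 = LinearMap.mulLeft k (r + z) - LinearMap.mulRight k (r + z) by
      conv_lhs => rw [this]
      simp
    refine b.ext ?_
    rintro (x | a)
    · have h1 : z * b (.inl x) - b (.inl x) * z = 0 := by
        simp [z, Finset.sum_mul, Finset.mul_sum, h.vertex_mul_vertex]
      have h2 : r * b (.inl x) = D.1 (b (.inl x)) * b (.inl x) := by
        simp [r, Finset.sum_mul, mul_assoc, h.vertex_mul_vertex]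
      have h3 : b (.inl x) * r = D.1 (b (.inl x)) * b (.inl x) - D.1 (b (.inl x)) := by
        have h4 : ∀ y, b (.inl x) * (D.1 (b (.inl y)) * b (.inl y)) =
            (if y = x then D.1 (b (.inl x)) * b (.inl x) else 0) -
              D.1 (b (.inl x)) * b (.inl y) := fun y => by
          have h5 := hD (b (.inl x)) (b (.inl y))
          rw [← mul_assoc, ← sub_eq_of_eq_add' h5, sub_mul, h.vertex_mul_vertex, mul_assoc,
            h.vertex_mul_vertex, if_pos rfl]
          by_cases hxy : x = y
          · subst hxy; simp
          · simp [hxy, Ne.symm hxy]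
        simp only [r, Finset.mul_sum, h4, Finset.sum_sub_distrib]
        rw [← Finset.mul_sum, h.sum_vertex]
        simp
      simp only [LinearMap.sub_apply, LinearMap.mulLeft_apply, LinearMap.mulRight_apply]
      rw [add_mul, mul_add, add_sub_add_comm, h1, h2, h3]
      abel
    · have h1 : ∀ a', b.coord (.inr a') (D.1 (b (.inr a))) = _ := fun a' => congrFun₂ hf a' a
      rw [h.derivation_arrow D.2]
      simp only [LinearMap.sub_apply, LinearMap.mulLeft_apply, LinearMap.mulRight_apply]
      rw [ad]
      simp only [map_add, hr, hz, h1, Matrix.diagonal_apply]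
      simp

end IsQuiverBasis

end QuiverBasis

/-! ### Block diagonal matrices: traceless part and block scalars -/

section BlockMatrices

variable {k : Type u} [Field k] {E W : Type*} [Fintype E] [DecidableEq E] [DecidableEq W]

/-- The matrix `M` is block diagonal with respect to the fibres of `q`. -/
def IsBlockMatrix (q : E → W) (M : Matrix E E k) : Prop := ∀ a b, q a ≠ q b → M a b = 0

/-- The trace of the block of a matrix at a fibre of `q`. -/
def blockTrace (q : E → W) (w : W) : Matrix E E k →ₗ[k] k where
  toFun M := ∑ a with q a = w, M a a
  map_add' M N := by simp [Finset.sum_add_distrib]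
  map_smul' c M := by simp [Finset.mul_sum]

omit [DecidableEq E] in
theorem blockTrace_apply (q : E → W) (w : W) (M : Matrix E E k) :
    blockTrace q w M = ∑ a with q a = w, M a a := rfl

omit [DecidableEq E] [DecidableEq W] in
theorem IsBlockMatrix.mul {q : E → W} {M N : Matrix E E k} (hM : IsBlockMatrix q M)
    (hN : IsBlockMatrix q N) : IsBlockMatrix q (M * N) := fun a b hab => by
  rw [Matrix.mul_apply]
  refine Finset.sum_eq_zero fun c _ => ?_
  by_cases hac : q a = q c
  · rw [hN c b (hac ▸ hab), mul_zero]
  · rw [hM a c hac, zero_mul]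

omit [DecidableEq E] in
theorem blockTrace_mul {q : E → W} {M N : Matrix E E k} (hM : IsBlockMatrix q M) (w : W) :
    blockTrace q w (M * N) = ∑ a with q a = w, ∑ c with q c = w, M a c * N c a := by
  rw [blockTrace_apply]
  refine Finset.sum_congr rfl fun a ha => ?_
  rw [Matrix.mul_apply, Finset.sum_filter]
  refine Finset.sum_congr rfl fun c _ => ?_
  split_ifs with hc
  · rfl
  · rw [hM a c (by rw [(Finset.mem_filter.1 ha).2]; exact Ne.symm hc), zero_mul]

theorem blockTrace_lie {q : E → W} {M N : Matrix E E k} (hM : IsBlockMatrix q M)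
    (hN : IsBlockMatrix q N) (w : W) : blockTrace q w ⁅M, N⁆ = 0 := by
  rw [Ring.lie_def, map_sub, blockTrace_mul hM, blockTrace_mul hN, Finset.sum_comm, sub_eq_zero]
  exact Finset.sum_congr rfl fun a _ => Finset.sum_congr rfl fun c _ => mul_comm _ _

/-- The Lie algebra of the block diagonal matrices all of whose blocks have trace zero. -/
def tracelessBlock (k : Type u) [Field k] (q : E → W) : LieSubalgebra k (Matrix E E k) where
  carrier := {M | IsBlockMatrix q M ∧ ∀ w, blockTrace q w M = 0}
  add_mem' := by
    rintro M N ⟨hM, hM'⟩ ⟨hN, hN'⟩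
    exact ⟨fun a b h => by simp [hM a b h, hN a b h], fun w => by simp [hM', hN']⟩
  zero_mem' := ⟨fun _ _ _ => rfl, fun w => map_zero _⟩
  smul_mem' := by
    rintro c M ⟨hM, hM'⟩
    exact ⟨fun a b h => by simp [hM a b h], fun w => by simp [hM']⟩
  lie_mem' := by
    rintro M N ⟨hM, hM'⟩ ⟨hN, hN'⟩
    refine ⟨fun a b h => ?_, blockTrace_lie hM hN⟩
    rw [Ring.lie_def, Matrix.sub_apply, hM.mul hN a b h, hN.mul hM a b h, sub_zero]

/-- The normalized traces of the blocks of a matrix. -/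
def blockMean (q : E → W) : Matrix E E k →ₗ[k] (Set.range q → k) :=
  LinearMap.pi fun w => ((Finset.card {a | q a = w.1} : k)⁻¹) • blockTrace q w.1

/-- The matrix which is scalar on the blocks. -/
def blockScalar (q : E → W) : (Set.range q → k) →ₗ[k] Matrix E E k where
  toFun z := Matrix.diagonal fun a => z ⟨q a, a, rfl⟩
  map_add' y z := by simp
  map_smul' c z := by
    ext a b
    by_cases hab : a = b
    · subst hab; simp
    · simp [hab]

omit [Fintype E] [DecidableEq W] in
theorem blockScalar_apply (q : E → W) (z : Set.range q → k) :
    blockScalar q z = Matrix.diagonal fun a => z ⟨q a, a, rfl⟩ := rfl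

omit [DecidableEq E] in
theorem card_fibre_ne_zero [CharZero k] (q : E → W) (w : Set.range q) :
    (Finset.card {a | q a = w.1} : k) ≠ 0 := by
  obtain ⟨_, a, rfl⟩ := w
  exact Nat.cast_ne_zero.2 (Finset.card_ne_zero_of_mem (a := a) (by simp))

theorem blockTrace_blockScalar (q : E → W) (z : Set.range q → k) (w : Set.range q) :
    blockTrace q w.1 (blockScalar q z) = Finset.card {a | q a = w.1} * z w := by
  rw [blockTrace_apply, ← nsmul_eq_mul]
  refine Finset.sum_eq_card_nsmul fun a ha => ?_
  have : (⟨q a, a, rfl⟩ : Set.range q) = w := Subtype.ext (Finset.mem_filter.1 ha).2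
  simp [blockScalar_apply, this]

theorem blockMean_blockScalar [CharZero k] (q : E → W) (z : Set.range q → k) :
    blockMean q (blockScalar q z) = z := by
  funext w
  simp only [blockMean, LinearMap.pi_apply, LinearMap.smul_apply, smul_eq_mul,
    blockTrace_blockScalar]
  exact inv_mul_cancel_left₀ (card_fibre_ne_zero q w) _

theorem blockMean_of_mem {q : E → W} {M : Matrix E E k} (hM : M ∈ tracelessBlock k q) :
    blockMean q M = 0 := by
  funext w
  simp [blockMean, hM.2]

omit [Fintype E] [DecidableEq W] in
theorem isBlockMatrix_blockScalar (q : E → W) (z : Set.range q → k) :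
    IsBlockMatrix q (blockScalar q z) := fun a b hab => by
  rw [blockScalar_apply, Matrix.diagonal_apply_ne _ fun h => hab (congrArg q h)]

/-- Block sizes are invertible in characteristic zero, so subtracting the mean of the diagonal makes
each block traceless. Over values not attained by `q` the trace is an empty sum. -/
theorem sub_blockScalar_mem [CharZero k] {q : E → W} {M : Matrix E E k} (hM : IsBlockMatrix q M) :
    M - blockScalar q (blockMean q M) ∈ tracelessBlock k q := by
  refine ⟨fun a b hab => ?_, fun w => ?_⟩
  · rw [Matrix.sub_apply, hM a b hab, isBlockMatrix_blockScalar q _ a b hab, sub_zero]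
  · by_cases hw : w ∈ Set.range q
    · have := blockTrace_blockScalar q (blockMean q M) ⟨w, hw⟩
      rw [map_sub, this]
      have h0 := card_fibre_ne_zero (k := k) q ⟨w, hw⟩
      simp only [blockMean, LinearMap.pi_apply, LinearMap.smul_apply, smul_eq_mul]
      rw [mul_inv_cancel_left₀ h0, sub_self]
    · rw [blockTrace_apply, Finset.sum_eq_zero]
      exact fun a ha => (hw ⟨a, (Finset.mem_filter.1 ha).2⟩).elim

theorem blockScalar_mul_comm {q : E → W} {M : Matrix E E k} (hM : IsBlockMatrix q M)
    (z : Set.range q → k) : blockScalar q z * M = M * blockScalar q z := by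
  ext a b
  rw [blockScalar_apply, Matrix.diagonal_mul, Matrix.mul_diagonal]
  by_cases hab : q a = q b
  · have : (⟨q a, a, rfl⟩ : Set.range q) = ⟨q b, b, rfl⟩ := Subtype.ext hab
    rw [this, mul_comm]
  · rw [hM a b hab, mul_zero, zero_mul]

/-- Block scalars are central among block matrices and do not affect the bracket. -/
theorem lie_sub_blockScalar {q : E → W} {M N : Matrix E E k} (hM : IsBlockMatrix q M)
    (hN : IsBlockMatrix q N) (y z : Set.range q → k) :
    ⁅M - blockScalar q y, N - blockScalar q z⁆ = ⁅M, N⁆ := by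
  have h1 := blockScalar_mul_comm hN y
  have h2 := blockScalar_mul_comm hM z
  have h3 := blockScalar_mul_comm (isBlockMatrix_blockScalar q z) y
  simp only [Ring.lie_def, mul_sub, sub_mul, h1, h2, h3]
  abel

theorem blockMean_lie {q : E → W} {M N : Matrix E E k} (hM : IsBlockMatrix q M)
    (hN : IsBlockMatrix q N) : blockMean q ⁅M, N⁆ = 0 := by
  funext w
  simp [blockMean, blockTrace_lie hM hN]

variable {E' W' : Type*} [Fintype E'] [DecidableEq E'] [DecidableEq W']

/-- Indices which form fibres of their own do not contribute to `tracelessBlock`. -/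
theorem nonempty_tracelessBlock_equiv {q : E → W} {q' : E' → W'} {j : E → E'}
    (hj : Function.Injective j) (hq : ∀ a b, q' (j a) = q' (j b) ↔ q a = q b)
    (hout : ∀ a ∉ Set.range j, ∀ b, q' a = q' b → a = b) :
    Nonempty (tracelessBlock k q' ≃ₗ⁅k⁆ tracelessBlock k q) := by
  have trace_submatrix : ∀ (M : Matrix E' E' k) (a : E),
      blockTrace q (q a) (M.submatrix j j) = blockTrace q' (q' (j a)) M := by
    intro M a
    rw [blockTrace_apply, blockTrace_apply]
    refine Finset.sum_bij (fun c _ => j c) ?_ (fun _ _ _ _ h => hj h) ?_ fun _ _ => rfl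
    · intro c hc
      simpa [hq] using hc
    · intro c hc
      have hc' := (Finset.mem_filter.1 hc).2
      by_cases hcj : c ∈ Set.range j
      · obtain ⟨c, rfl⟩ := hcj
        exact ⟨c, by simpa [hq] using hc', rfl⟩
      · exact (hcj ⟨a, (hout c hcj _ hc').symm⟩).elim
  have mem_submatrix : ∀ M ∈ tracelessBlock k q', M.submatrix j j ∈ tracelessBlock k q := by
    refine fun M hM => ⟨fun a b hab => hM.1 _ _ fun h => hab ((hq a b).1 h), fun w => ?_⟩
    by_cases hw : w ∈ Set.range q
    · obtain ⟨a, rfl⟩ := hw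
      rw [trace_submatrix, hM.2]
    · rw [blockTrace_apply, Finset.sum_eq_zero]
      exact fun a ha => (hw ⟨a, (Finset.mem_filter.1 ha).2⟩).elim
  have submatrix_mul : ∀ M N : Matrix E' E' k, IsBlockMatrix q' M →
      (M * N).submatrix j j = M.submatrix j j * N.submatrix j j := by
    intro M N hM
    ext a b
    rw [Matrix.submatrix_apply, Matrix.mul_apply, Matrix.mul_apply]
    -- An index outside the range of `j` is alone in its fibre, so it contributes nothing to the
    -- product.
    refine (Finset.sum_of_injOn j hj.injOn (fun _ _ => by simp) (fun c _ hc => ?_)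
      fun _ _ => rfl).symm
    have hc' : c ∉ Set.range j := by simpa using hc
    rw [hM (j a) c fun h => hc' ⟨a, (hout c hc' _ h.symm).symm⟩, zero_mul]
  let φ : tracelessBlock k q' →ₗ⁅k⁆ tracelessBlock k q :=
    { toFun := fun M => ⟨M.1.submatrix j j, mem_submatrix M.1 M.2⟩
      map_add' := fun M N => rfl
      map_smul' := fun c M => rfl
      map_lie' := fun {M N} => by
        refine Subtype.ext ?_
        change (⁅M.1, N.1⁆).submatrix j j = ⁅M.1.submatrix j j, N.1.submatrix j j⁆
        rw [Ring.lie_def, Ring.lie_def, ← submatrix_mul _ _ M.2.1, ← submatrix_mul _ _ N.2.1]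
        rfl }
  -- Such an index carries a block of size one, and a traceless block of size one is zero.
  have entry_out : ∀ M ∈ tracelessBlock k q', ∀ a b, (a ∉ Set.range j ∨ b ∉ Set.range j) →
      M a b = 0 := by
    intro M hM a b hab
    by_cases h : q' a = q' b
    · have hab' : a = b := by
        rcases hab with hab | hab
        · exact hout a hab b h
        · exact (hout b hab a h.symm).symm
      subst hab'
      have ha : a ∉ Set.range j := by tauto
      have h1 := hM.2 (q' a)
      rw [blockTrace_apply, Finset.sum_eq_single a] at h1
      · exact h1
      · exact fun c hc hca => (hca (hout a ha c (Finset.mem_filter.1 hc).2.symm).symm).elim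
      · simp
    · exact hM.1 a b h
  refine ⟨LieEquiv.ofBijective φ ⟨?_, ?_⟩⟩
  · intro M N hMN
    refine Subtype.ext (Matrix.ext fun a b => ?_)
    by_cases ha : a ∈ Set.range j
    · by_cases hb : b ∈ Set.range j
      · obtain ⟨a, rfl⟩ := ha
        obtain ⟨b, rfl⟩ := hb
        exact congrFun₂ (congrArg Subtype.val hMN) a b
      · rw [entry_out M.1 M.2 a b (Or.inr hb), entry_out N.1 N.2 a b (Or.inr hb)]
    · rw [entry_out M.1 M.2 a b (Or.inl ha), entry_out N.1 N.2 a b (Or.inl ha)]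
  · intro N
    -- The preimage of `N` is its extension by zero.
    let M : Matrix E' E' k := Matrix.of fun a b => Function.extend j
      (fun a' => Function.extend j (fun b' => N.1 a' b') 0 b) 0 a
    have hMN : M.submatrix j j = N.1 := by
      ext a b
      simp [M, hj.extend_apply]
    have hout' : ∀ a b, (a ∉ Set.range j ∨ b ∉ Set.range j) → M a b = 0 := by
      intro a b hab
      by_cases ha : a ∈ Set.range j
      · have hb : b ∉ Set.range j := by tauto
        obtain ⟨a, rfl⟩ := ha
        simp only [M, Matrix.of_apply, hj.extend_apply]
        rw [Function.extend_apply' _ _ _ hb, Pi.zero_apply]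
      · simp only [M, Matrix.of_apply]
        rw [Function.extend_apply' _ _ _ ha, Pi.zero_apply]
    refine ⟨⟨M, fun a b hab => ?_, fun w => ?_⟩, Subtype.ext hMN⟩
    · by_cases ha : a ∈ Set.range j
      · by_cases hb : b ∈ Set.range j
        · obtain ⟨a, rfl⟩ := ha
          obtain ⟨b, rfl⟩ := hb
          exact (congrFun₂ hMN a b).trans (N.2.1 a b fun h => hab ((hq a b).2 h))
        · exact hout' a b (Or.inr hb)
      · exact hout' a b (Or.inl ha)
    · by_cases hw : ∃ a, q' (j a) = w
      · obtain ⟨a, rfl⟩ := hw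
        rw [← trace_submatrix, hMN, N.2.2]
      · rw [blockTrace_apply, Finset.sum_eq_zero]
        intro a ha
        refine hout' a a (Or.inl ?_)
        rintro ⟨a, rfl⟩
        exact hw ⟨a, (Finset.mem_filter.1 ha).2⟩

end BlockMatrices

/-! ### The structure of HH¹ and its change under gluing -/

section HH1

variable {k : Type u} [Field k]

/-- The ends of an arrow. -/
def ends {E V : Type*} (s t : E → V) (a : E) : V × V := (s a, t a)

/-- The map from functions on the vertices to functions on the parallel classes of arrows, which
takes the difference of the values at the end and at the start. -/
def vertexDiff (k : Type u) [Field k] {E V : Type*} (s t : E → V) :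
    (V → k) →ₗ[k] (Set.range (ends s t) → k) where
  toFun f w := f w.1.2 - f w.1.1
  map_add' f g := by funext w; simp only [Pi.add_apply]; ring
  map_smul' c f := by funext w; simp [mul_sub]

theorem mem_ker_vertexDiff {E V : Type*} {s t : E → V} {f : V → k} :
    f ∈ LinearMap.ker (vertexDiff k s t) ↔ ∀ a, f (t a) = f (s a) := by
  rw [LinearMap.mem_ker, funext_iff]
  constructor
  · exact fun h a => sub_eq_zero.1 (h ⟨_, a, rfl⟩)
  · rintro h ⟨_, a, rfl⟩
    exact sub_eq_zero.2 (h a)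

theorem nonempty_quotient_lieEquiv {L G : Type*} [LieRing L] [LieAlgebra k L] [LieRing G]
    [LieAlgebra k G] (φ : L →ₗ⁅k⁆ G) (hφ : Function.Surjective φ) {J : LieIdeal k L}
    (hJ : ∀ x, x ∈ J ↔ φ x = 0) : Nonempty ((L ⧸ J) ≃ₗ⁅k⁆ G) := by
  obtain rfl : φ.ker = J := LieSubmodule.ext _ _ fun x => by rw [hJ, LieHom.mem_ker]
  exact ⟨φ.quotKerEquivRange.trans ((LieEquiv.ofEq _ ⊤
    (by rw [(LieHom.range_eq_top φ).2 hφ])).trans LieSubalgebra.topEquiv)⟩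

/-- Inner derivations are the block scalars in the range of `vertexDiff`. They leave the traceless
part untouched and cut the centre down to the cokernel of `vertexDiff`, of dimension `n`. -/
theorem IsQuiverBasis.nonempty_HH1_equiv [CharZero k] {R : Type v} [Ring R] [Algebra k R]
    {V E : Type*} [Fintype V] [DecidableEq V] [Fintype E] [DecidableEq E] {s t : E → V}
    {b : Module.Basis (V ⊕ E) k R} (h : IsQuiverBasis s t b) {n : ℕ}
    (hn : n + Module.finrank k (LinearMap.range (vertexDiff k s t)) =
      (Set.range (ends s t)).ncard) :
    Nonempty (HH1 k R ≃ₗ⁅k⁆ (tracelessBlock k (ends s t) × (Fin n → k))) := by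
  have hblock : ∀ D, IsBlockMatrix (ends s t) (h.arrowMatrix D) :=
    fun D _ _ hab => h.arrowMatrix_eq_zero D hab
  have hrank : Module.finrank k
      ((Set.range (ends s t) → k) ⧸ LinearMap.range (vertexDiff k s t)) =
      Module.finrank k (Fin n → k) := by
    have h1 := Submodule.finrank_quotient_add_finrank (LinearMap.range (vertexDiff k s t))
    rw [Module.finrank_fintype_fun_eq_card, ← Nat.card_eq_fintype_card,
      Nat.card_coe_set_eq] at h1
    rw [Module.finrank_fin_fun]
    omega
  -- Any linear identification will do, as both sides are abelian.
  let e := LinearEquiv.ofFinrankEq _ _ hrank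
  let p : (Set.range (ends s t) → k) →ₗ[k] (Fin n → k) := e.toLinearMap ∘ₗ Submodule.mkQ _
  have hp : ∀ z, p z = 0 ↔ ∃ f, vertexDiff k s t f = z := fun z => by simp [p]
  have hps : Function.Surjective p := e.surjective.comp (Submodule.mkQ_surjective _)
  let φ : derivations k R →ₗ⁅k⁆ (tracelessBlock k (ends s t) × (Fin n → k)) :=
    { toFun := fun D => (⟨_, sub_blockScalar_mem (hblock D)⟩, p (blockMean _ (h.arrowMatrix D)))
      map_add' := fun D D' => by
        refine Prod.ext (Subtype.ext ?_) ?_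
        · change h.arrowMatrix (D + D') - blockScalar _ (blockMean _ (h.arrowMatrix (D + D'))) =
            (h.arrowMatrix D - _) + (h.arrowMatrix D' - _)
          rw [map_add, map_add, map_add]
          abel
        · simp
      map_smul' := fun c D => by
        refine Prod.ext (Subtype.ext ?_) ?_
        · simp [smul_sub]
        · simp
      map_lie' := fun {D D'} => by
        refine Prod.ext (Subtype.ext ?_) ?_
        · change h.arrowMatrix ⁅D, D'⁆ - blockScalar _ (blockMean _ (h.arrowMatrix ⁅D, D'⁆)) =
            ⁅h.arrowMatrix D - blockScalar _ _, h.arrowMatrix D' - blockScalar _ _⁆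
          rw [lie_sub_blockScalar (hblock D) (hblock D'), LieHom.map_lie,
            blockMean_lie (hblock D) (hblock D'), map_zero, sub_zero]
        · change p (blockMean _ (h.arrowMatrix ⁅D, D'⁆)) = ⁅p _, p _⁆
          rw [LieHom.map_lie, blockMean_lie (hblock D) (hblock D'), map_zero, Ring.lie_def,
            mul_comm, sub_self] }
  refine nonempty_quotient_lieEquiv φ ?_ fun D => ?_
  · rintro ⟨N, y⟩
    obtain ⟨z, rfl⟩ := hps y
    obtain ⟨D, hD⟩ := h.exists_arrowMatrix_eq (N.1 + blockScalar (ends s t) z) fun a' a ha => by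
      rw [Matrix.add_apply, N.2.1 a' a ha, isBlockMatrix_blockScalar _ z a' a ha, add_zero]
    have hmean : blockMean (ends s t) (h.arrowMatrix D) = z := by
      rw [hD, map_add, blockMean_of_mem N.2, blockMean_blockScalar, zero_add]
    refine ⟨D, Prod.ext (Subtype.ext ?_) ?_⟩
    · change h.arrowMatrix D - blockScalar _ (blockMean _ (h.arrowMatrix D)) = N.1
      rw [hmean, hD, add_sub_cancel_right]
    · change p (blockMean _ (h.arrowMatrix D)) = _
      rw [hmean]
  · have hdiff : ∀ f : V → k, (Matrix.diagonal fun a => f (t a) - f (s a)) =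
        blockScalar (ends s t) (vertexDiff k s t f) := fun f => rfl
    rw [h.mem_innerDerivations_iff]
    simp_rw [hdiff]
    constructor
    · rintro ⟨f, hf⟩
      refine Prod.ext (Subtype.ext ?_) ?_
      · change h.arrowMatrix D - blockScalar _ (blockMean _ (h.arrowMatrix D)) = 0
        rw [hf, blockMean_blockScalar, sub_self]
      · change p (blockMean _ (h.arrowMatrix D)) = 0
        rw [hf, blockMean_blockScalar, hp]
        exact ⟨f, rfl⟩
    · intro hD
      obtain ⟨f, hf⟩ := (hp _).1 (congrArg Prod.snd hD)
      exact ⟨f, by rw [hf]; exact sub_eq_zero.1 (congrArg (fun x => (Prod.fst x).1) hD)⟩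

/-- Two algebras with quiver bases such that the second quiver is obtained from the first one by
gluing the arrow `a₀`, which is not parallel to any other arrow, to another arrow `a₁`. -/
theorem IsQuiverBasis.nonempty_HH1_equiv_prod [CharZero k]
    {A : Type v} [Ring A] [Algebra k A] {B : Type w} [Ring B] [Algebra k B]
    {V E V' E' : Type*} [Fintype V] [DecidableEq V] [Fintype E] [DecidableEq E]
    [Fintype V'] [DecidableEq V'] [Fintype E'] [DecidableEq E'] {s t : E → V} {s' t' : E' → V'}
    {b : Module.Basis (V ⊕ E) k B} {b' : Module.Basis (V' ⊕ E') k A}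
    (hB : IsQuiverBasis s t b) (hA : IsQuiverBasis s' t' b') {j : E → E'} {π : V' → V}
    {a₀ : E'} {a₁ : E} (hj : Function.Injective j) (hrange : ∀ a, a ∈ Set.range j ↔ a ≠ a₀)
    (ha₀ : ∀ a, ends s' t' a₀ = ends s' t' a → a₀ = a)
    (hends : ∀ a c, ends s' t' (j a) = ends s' t' (j c) ↔ ends s t a = ends s t c)
    (hπ : Function.Surjective π) (hs : ∀ a, π (s' (j a)) = s a) (ht : ∀ a, π (t' (j a)) = t a)
    (hs₀ : π (s' a₀) = s a₁) (ht₀ : π (t' a₀) = t a₁)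
    (hconn : ∀ f : V' → k, (∀ a, f (t' a) = f (s' a)) → ∀ x y, π x = π y → f x = f y)
    (hcard : Fintype.card V' = Fintype.card V + 2) :
    Nonempty (HH1 k B ≃ₗ⁅k⁆ (HH1 k A × k)) := by
  -- By `hconn`, functions constant along the arrows of the large quiver factor through `π`.
  have hker : LinearMap.ker (vertexDiff k s' t') =
      (LinearMap.ker (vertexDiff k s t)).map (LinearMap.funLeft k k π) := by
    ext f
    rw [Submodule.mem_map, mem_ker_vertexDiff]
    constructor
    · intro hf
      have hfac : ∀ x, f (Function.surjInv hπ (π x)) = f x :=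
        fun x => hconn f hf _ _ (Function.surjInv_eq hπ _)
      refine ⟨f ∘ Function.surjInv hπ, mem_ker_vertexDiff.2 fun a => ?_, funext hfac⟩
      rw [Function.comp_apply, Function.comp_apply, ← hs, ← ht, hfac, hfac, hf]
    · rintro ⟨f, hf, rfl⟩ a
      rw [mem_ker_vertexDiff] at hf
      rw [LinearMap.funLeft_apply, LinearMap.funLeft_apply]
      by_cases ha : a ∈ Set.range j
      · obtain ⟨a, rfl⟩ := ha
        rw [hs, ht, hf]
      · obtain rfl : a = a₀ := by simpa [hrange] using ha
        rw [hs₀, ht₀, hf]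
  have hker' : Module.finrank k (LinearMap.ker (vertexDiff k s' t')) =
      Module.finrank k (LinearMap.ker (vertexDiff k s t)) := by
    rw [hker]
    exact (Submodule.equivMapOfInjective _
      (LinearMap.funLeft_injective_of_surjective k k π hπ) _).finrank_eq.symm
  -- The class of `a₀` is a singleton; the remaining classes correspond under `π` by `hends`.
  have hclasses : (Set.range (ends s' t')).ncard = (Set.range (ends s t)).ncard + 1 := by
    have h1 : Set.range (ends s' t') = insert (ends s' t' a₀) (Set.range (ends s' t' ∘ j)) := by
      ext w
      constructor
      · rintro ⟨a, rfl⟩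
        by_cases ha : a ∈ Set.range j
        · obtain ⟨a, rfl⟩ := ha
          exact Or.inr ⟨a, rfl⟩
        · obtain rfl : a = a₀ := by simpa [hrange] using ha
          exact Or.inl rfl
      · rintro (rfl | ⟨a, rfl⟩)
        exacts [⟨_, rfl⟩, ⟨_, rfl⟩]
    have h2 : Set.range (ends s t) = Prod.map π π '' Set.range (ends s' t' ∘ j) := by
      rw [← Set.range_comp]
      exact congrArg Set.range (funext fun a => Prod.ext (hs a).symm (ht a).symm)
    have h3 : Set.InjOn (Prod.map π π) (Set.range (ends s' t' ∘ j)) := by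
      rintro _ ⟨a, rfl⟩ _ ⟨c, rfl⟩ hac
      refine (hends a c).2 (Prod.ext ?_ ?_)
      · exact (hs a).symm.trans ((congrArg Prod.fst hac).trans (hs c))
      · exact (ht a).symm.trans ((congrArg Prod.snd hac).trans (ht c))
    rw [h2, h3.ncard_image, h1, Set.ncard_insert_of_notMem]
    rintro ⟨a, ha⟩
    exact (hrange _).1 ⟨a, rfl⟩ (ha₀ _ ha.symm).symm
  have r1 := (vertexDiff k s t).finrank_range_add_finrank_ker
  have r2 := (vertexDiff k s' t').finrank_range_add_finrank_ker
  rw [Module.finrank_fintype_fun_eq_card] at r1 r2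
  have hle := Submodule.finrank_le (LinearMap.range (vertexDiff k s' t'))
  rw [Module.finrank_fintype_fun_eq_card, ← Nat.card_eq_fintype_card, Nat.card_coe_set_eq] at hle
  obtain ⟨n, hn⟩ := Nat.exists_eq_add_of_le' hle
  obtain ⟨eA⟩ := hA.nonempty_HH1_equiv hn.symm
  -- Equal kernels and `hcard` make the rank for `A` larger by two, and the number of classes is
  -- larger by one; hence `n + 1` for `B`.
  obtain ⟨eB⟩ := hB.nonempty_HH1_equiv (n := n + 1) (by omega)
  obtain ⟨eS⟩ := nonempty_tracelessBlock_equiv (k := k) (q := ends s t) (q' := ends s' t') hj hends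
    fun a ha c hac => by
      obtain rfl : a = a₀ := by simpa [hrange] using ha
      exact ha₀ c hac
  -- The factor `k` supplies the additional abelian coordinate.
  let ψ : HH1 k A × k →ₗ⁅k⁆ (tracelessBlock k (ends s t) × (Fin (n + 1) → k)) :=
    { toFun := fun x => (eS (eA x.1).1, Fin.cons x.2 (eA x.1).2)
      map_add' := fun x y => by
        refine Prod.ext (by simp) (funext fun i => ?_)
        refine Fin.cases ?_ (fun i => ?_) i <;> simp
      map_smul' := fun c x => by
        refine Prod.ext (by simp) (funext fun i => ?_)
        refine Fin.cases ?_ (fun i => ?_) i <;> simp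
      map_lie' := fun {x y} => by
        have h1 : eA ⁅x.1, y.1⁆ = ⁅eA x.1, eA y.1⁆ := LieEquiv.map_lie eA x.1 y.1
        refine Prod.ext ?_ (funext fun i => ?_)
        · rw [LieAlgebra.Prod.bracket_apply, LieAlgebra.Prod.bracket_apply, h1]
          exact LieEquiv.map_lie eS _ _
        · refine Fin.cases ?_ (fun i => ?_) i <;> simp [h1, Ring.lie_def, mul_comm] }
  refine ⟨eB.trans (LieEquiv.ofBijective ψ ⟨fun x y hxy => ?_, fun y => ?_⟩).symm⟩
  · have h1 := eS.injective (congrArg Prod.fst hxy)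
    have h2 := Fin.cons_injective2 (α := fun _ => k) (congrArg Prod.snd hxy)
    exact Prod.ext (eA.injective (Prod.ext h1 h2.2)) h2.1
  · refine ⟨(eA.symm (eS.symm y.1, Fin.tail y.2), y.2 0), Prod.ext ?_ ?_⟩
    · simp [ψ]
    · simp [ψ]

end HH1

/-! ### The subalgebra spanned by fibre sums -/

section FibreSums

variable {k : Type*} [Field k] {A : Type*} [Ring A] [Algebra k A] {V E V' E' : Type*}
  [Fintype V'] [Fintype E'] [DecidableEq V] [DecidableEq E]

/-- The sum of the basis elements in the fibre of a map of quivers. -/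
def fibreSum (b' : Module.Basis (V' ⊕ E') k A) (π : V' → V) (ρ : E' → E) (i : V ⊕ E) : A :=
  ∑ i' with Sum.map π ρ i' = i, b' i'

variable {b' : Module.Basis (V' ⊕ E') k A} {π : V' → V} {ρ : E' → E}

theorem fibreSum_inl (v : V) :
    fibreSum b' π ρ (.inl v) = ∑ x with π x = v, b' (.inl x) := by
  simp [fibreSum, Finset.sum_filter]

theorem fibreSum_inr (c : E) :
    fibreSum b' π ρ (.inr c) = ∑ a with ρ a = c, b' (.inr a) := by
  simp [fibreSum, Finset.sum_filter]

theorem coord_fibreSum (i : V ⊕ E) (i' : V' ⊕ E') :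
    b'.coord i' (fibreSum b' π ρ i) = if Sum.map π ρ i' = i then 1 else 0 := by
  classical
  rw [fibreSum, map_sum, Finset.sum_filter, Finset.sum_eq_single i']
  · simp [apply_ite]
  · intro c _ hc
    simp [Finsupp.single_eq_of_ne hc.symm]
  · simp

/-- Distinct fibres are disjoint, and surjectivity makes them nonempty; any member of a fibre
detects its coefficient. -/
theorem linearIndependent_fibreSum [Fintype V] [Fintype E] (hπ : Function.Surjective π)
    (hρ : Function.Surjective ρ) : LinearIndependent k (fibreSum b' π ρ) := by
  rw [Fintype.linearIndependent_iff]
  intro g hg i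
  obtain ⟨i', rfl⟩ := Sum.map_surjective.2 ⟨hπ, hρ⟩ i
  have h1 := congrArg (b'.coord i') hg
  simp only [map_sum, map_smul, coord_fibreSum, map_zero] at h1
  simpa using h1

variable [DecidableEq V'] {s' t' : E' → V'} {s t : E → V}

theorem fibreSum_vertex_mul_vertex (h : IsQuiverBasis s' t' b') (v w : V) :
    fibreSum b' π ρ (.inl v) * fibreSum b' π ρ (.inl w) =
      if v = w then fibreSum b' π ρ (.inl v) else 0 := by
  have h1 : ∀ y, fibreSum b' π ρ (.inl v) * b' (.inl y) = if π y = v then b' (.inl y) else 0 := by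
    intro y
    rw [fibreSum_inl, Finset.sum_mul]
    simp [h.vertex_mul_vertex]
  rw [fibreSum_inl w, Finset.mul_sum]
  simp_rw [h1]
  split_ifs with hvw
  · subst hvw
    rw [fibreSum_inl]
    exact Finset.sum_congr rfl fun y hy => if_pos (Finset.mem_filter.1 hy).2
  · refine Finset.sum_eq_zero fun y hy => if_neg ?_
    rw [(Finset.mem_filter.1 hy).2]
    exact Ne.symm hvw

theorem fibreSum_vertex_mul_arrow (h : IsQuiverBasis s' t' b') (ht : ∀ a, π (t' a) = t (ρ a))
    (v : V) (c : E) : fibreSum b' π ρ (.inl v) * fibreSum b' π ρ (.inr c) =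
      if t c = v then fibreSum b' π ρ (.inr c) else 0 := by
  rw [fibreSum_inr, Finset.mul_sum, ← Finset.sum_const_zero (s := Finset.univ.filter (ρ · = c)),
    ← Finset.sum_ite_irrel]
  refine Finset.sum_congr rfl fun a ha => ?_
  rw [h.mul_arrow, coord_fibreSum, ite_smul, one_smul, zero_smul]
  simp [ht, (Finset.mem_filter.1 ha).2]

theorem fibreSum_arrow_mul_vertex (h : IsQuiverBasis s' t' b') (hs : ∀ a, π (s' a) = s (ρ a))
    (c : E) (v : V) : fibreSum b' π ρ (.inr c) * fibreSum b' π ρ (.inl v) =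
      if s c = v then fibreSum b' π ρ (.inr c) else 0 := by
  rw [fibreSum_inr, Finset.sum_mul, ← Finset.sum_const_zero (s := Finset.univ.filter (ρ · = c)),
    ← Finset.sum_ite_irrel]
  refine Finset.sum_congr rfl fun a ha => ?_
  rw [h.arrow_mul, coord_fibreSum, ite_smul, one_smul, zero_smul]
  simp [hs, (Finset.mem_filter.1 ha).2]

theorem fibreSum_arrow_mul_arrow (h : IsQuiverBasis s' t' b') (c d : E) :
    fibreSum b' π ρ (.inr c) * fibreSum b' π ρ (.inr d) = 0 := by
  rw [fibreSum_inr d, Finset.mul_sum]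
  refine Finset.sum_eq_zero fun a _ => ?_
  rw [h.mul_arrow, coord_fibreSum]
  simp

variable [Fintype V]

theorem sum_fibreSum_vertex (h : IsQuiverBasis s' t' b') :
    ∑ v, fibreSum b' π ρ (.inl v) = 1 := by
  simp_rw [fibreSum_inl]
  rw [Finset.sum_fiberwise, h.sum_vertex]

/-- The fibre sums multiply like vertices and arrows of the glued quiver and their vertices sum to
`1`, so their span is already a subalgebra. -/
theorem adjoin_fibreSum_eq_span (h : IsQuiverBasis s' t' b') (hs : ∀ a, π (s' a) = s (ρ a))
    (ht : ∀ a, π (t' a) = t (ρ a)) :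
    Submodule.span k (Set.range (fibreSum b' π ρ)) =
      Subalgebra.toSubmodule (Algebra.adjoin k (Set.range (fibreSum b' π ρ))) := by
  have hmul : ∀ i j, fibreSum b' π ρ i * fibreSum b' π ρ j ∈
      Submodule.span k (Set.range (fibreSum b' π ρ)) := by
    have hmem : ∀ (i) (p : Prop) [Decidable p], (if p then fibreSum b' π ρ i else 0) ∈
        Submodule.span k (Set.range (fibreSum b' π ρ)) := by
      intro i p _
      split_ifs
      exacts [Submodule.subset_span ⟨i, rfl⟩, Submodule.zero_mem _]
    rintro (v | c) (w | d)
    · rw [fibreSum_vertex_mul_vertex h]; exact hmem _ _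
    · rw [fibreSum_vertex_mul_arrow h ht]; exact hmem _ _
    · rw [fibreSum_arrow_mul_vertex h hs]; exact hmem _ _
    · rw [fibreSum_arrow_mul_arrow h]; exact Submodule.zero_mem _
  refine le_antisymm (Submodule.span_le.2 Algebra.subset_adjoin) fun x hx => ?_
  refine Algebra.adjoin_induction (fun y hy => Submodule.subset_span hy) (fun r => ?_)
    (fun y z _ _ => Submodule.add_mem _) (fun y z _ _ hy hz => ?_) hx
  · rw [Algebra.algebraMap_eq_smul_one, ← sum_fibreSum_vertex (π := π) (ρ := ρ) h]
    exact Submodule.smul_mem _ _ (Submodule.sum_mem _ fun v _ => Submodule.subset_span ⟨_, rfl⟩)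
  · have h1 := Submodule.mul_mem_mul hy hz
    rw [Submodule.span_mul_span] at h1
    refine Submodule.span_le.2 ?_ h1
    rintro _ ⟨_, ⟨i, rfl⟩, _, ⟨j, rfl⟩, rfl⟩
    exact hmul i j

theorem IsQuiverBasis.exists_adjoin_fibreSum [Fintype E] (h : IsQuiverBasis s' t' b')
    (hs : ∀ a, π (s' a) = s (ρ a)) (ht : ∀ a, π (t' a) = t (ρ a)) (hπ : Function.Surjective π)
    (hρ : Function.Surjective ρ) :
    ∃ b : Module.Basis (V ⊕ E) k (Algebra.adjoin k (Set.range (fibreSum b' π ρ))),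
      IsQuiverBasis s t b := by
  let b := (Module.Basis.span (linearIndependent_fibreSum (b' := b') hπ hρ)).map
    ((LinearEquiv.ofEq _ _ (adjoin_fibreSum_eq_span h hs ht)).trans
      (Subalgebra.toSubmoduleEquiv _))
  have hb : ∀ i, (b i : A) = fibreSum b' π ρ i := fun i =>
    congrArg Subtype.val
      (Module.Basis.span_apply (linearIndependent_fibreSum (b' := b') hπ hρ) i)
  refine ⟨b, ⟨fun x y => ?_, fun x a => ?_, fun a x => ?_, fun a c => ?_, ?_⟩⟩ <;>
    refine Subtype.ext ?_
  · rw [Subalgebra.coe_mul, hb, hb, fibreSum_vertex_mul_vertex h]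
    split_ifs <;> simp [hb]
  · rw [Subalgebra.coe_mul, hb, hb, fibreSum_vertex_mul_arrow h ht]
    split_ifs <;> simp [hb]
  · rw [Subalgebra.coe_mul, hb, hb, fibreSum_arrow_mul_vertex h hs]
    split_ifs <;> simp [hb]
  · rw [Subalgebra.coe_mul, hb, hb, fibreSum_arrow_mul_arrow h]
    rfl
  · rw [Subalgebra.coe_one, ← sum_fibreSum_vertex (π := π) (ρ := ρ) h]
    simp [hb]

end FibreSums

/-! ### Radical square zero quotients of path algebras -/

section RadicalSquareZero

theorem mem_jacobson_of_isNilpotent_mul {R : Type*} [Ring R] {x : R}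
    (hx : ∀ y, IsNilpotent (y * x)) : x ∈ Ring.jacobson R := by
  rw [← Ideal.jacobson_bot, Ideal.mem_jacobson_iff]
  intro y
  obtain ⟨z, hz⟩ := (hx y).isUnit_one_add.exists_left_inv
  refine ⟨z, ?_⟩
  rw [Ideal.mem_bot, ← hz]
  noncomm_ring

variable {k : Type w} [Field k] {V : Type u} [Quiver.{v} V]

variable (k V) in
/-- The basis of the path algebra consisting of the paths. -/
def pathBasis : Module.Basis (TPath V) k (PathAlgebra k V) :=
  Module.Basis.ofRepr (LinearEquiv.refl k (TPath V →₀ k))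

theorem pathBasis_apply (p : TPath V) : pathBasis k V p = ofPath k p := rfl

theorem mem_span_range_ofPath (x : PathAlgebra k V) :
    x ∈ Submodule.span k (Set.range (ofPath k (V := V))) :=
  (pathBasis k V).mem_span x

/-- The trivial paths and the arrows, as paths. -/
def shortPath : V ⊕ Total V → TPath V := Sum.elim vertexPath arrowPath

theorem exists_shortPath_of_length_lt {p : TPath V} (hp : p.2.2.length < 2) :
    ∃ i, shortPath i = p := by
  obtain ⟨x, y, p⟩ := p
  match p, hp with
  | Path.nil, _ => exact ⟨.inl x, rfl⟩
  | Path.cons Path.nil a, _ => exact ⟨.inr ⟨_, _, a⟩, rfl⟩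
  | Path.cons (Path.cons _ _) _, hp => simp at hp

theorem length_shortPath_lt (i : V ⊕ Total V) : (shortPath i).2.2.length < 2 := by
  rcases i with x | a <;> simp [shortPath, vertexPath, arrowPath]

theorem shortPath_injective : Function.Injective (shortPath (V := V)) := by
  rintro (x | a) (y | c) h
  · exact congrArg Sum.inl (congrArg Sigma.fst h)
  · exact absurd (congrArg (fun p : TPath V => p.2.2.length) h)
      (by simp [shortPath, vertexPath, arrowPath])
  · exact absurd (congrArg (fun p : TPath V => p.2.2.length) h)
      (by simp [shortPath, vertexPath, arrowPath])
  · obtain ⟨x, y, a⟩ := a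
    obtain ⟨x', y', c⟩ := c
    obtain rfl : x = x' := congrArg Sigma.fst h
    obtain rfl : y = y' := congrArg (fun p : TPath V => p.2.1) h
    simpa [shortPath, arrowPath, Hom.toPath] using h

theorem coord_eq_zero_of_mem_arrowIdealPow {m : ℕ} {x : PathAlgebra k V}
    (hx : x ∈ arrowIdealPow k V m) {p : TPath V} (hp : p.2.2.length < m) :
    (pathBasis k V).coord p x = 0 := by
  refine Submodule.span_induction (fun y hy => ?_) (map_zero _)
    (fun y z _ _ hy hz => by rw [map_add, hy, hz, add_zero])
    (fun c y _ hy => by rw [map_smul, hy, smul_zero]) hx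
  obtain ⟨q, hq, rfl⟩ := hy
  rw [← pathBasis_apply, Module.Basis.coord_apply, Module.Basis.repr_self,
    Finsupp.single_eq_of_ne]
  rintro rfl
  omega

variable [Fintype V]

omit [Fintype V] in
theorem ofPath_mul_ofPath {x y z : V} (q : Path y z) (p : Path x y) :
    ofPath k ⟨y, z, q⟩ * ofPath k ⟨x, y, p⟩ = ofPath k ⟨x, z, p.comp q⟩ :=
  (mulLin_ofPath _ _).trans (pathMul_of_comp q p)

theorem ofPath_mul_ofPath_of_ne {q p : TPath V} (h : p.2.1 ≠ q.1) :
    ofPath k q * ofPath k p = 0 :=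
  (mulLin_ofPath _ _).trans (pathMul_of_ne h)

theorem mul_mem_arrowIdealPow {m n : ℕ} {x y : PathAlgebra k V} (hx : x ∈ arrowIdealPow k V m)
    (hy : y ∈ arrowIdealPow k V n) : x * y ∈ arrowIdealPow k V (m + n) := by
  have h1 := Submodule.mul_mem_mul hx hy
  rw [arrowIdealPow, arrowIdealPow, Submodule.span_mul_span] at h1
  refine Submodule.span_le.2 ?_ h1
  rintro _ ⟨_, ⟨q, hq, rfl⟩, _, ⟨p, hp, rfl⟩, rfl⟩
  obtain ⟨a, c, q⟩ := q
  obtain ⟨d, e, p⟩ := p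
  by_cases h : e = a
  · subst h
    change ofPath k _ * ofPath k _ ∈ _
    rw [ofPath_mul_ofPath]
    refine Submodule.subset_span ⟨_, ?_, rfl⟩
    simp only [Path.length_comp] at hq hp ⊢
    omega
  · change ofPath k _ * ofPath k _ ∈ _
    rw [ofPath_mul_ofPath_of_ne h]
    exact Submodule.zero_mem _

omit [Fintype V] in
theorem mem_arrowIdealPow_zero (x : PathAlgebra k V) : x ∈ arrowIdealPow k V 0 := by
  refine Submodule.span_mono ?_ (mem_span_range_ofPath x)
  rintro _ ⟨p, rfl⟩
  exact ⟨p, Nat.zero_le _, rfl⟩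

theorem pow_mem_arrowIdealPow {x : PathAlgebra k V} (hx : x ∈ arrowIdealPow k V 1) (n : ℕ) :
    x ^ n ∈ arrowIdealPow k V n := by
  induction n with
  | zero => exact mem_arrowIdealPow_zero _
  | succ n ih => rw [pow_succ]; exact mul_mem_arrowIdealPow ih hx

variable {I : Ideal (PathAlgebra k V)} [I.IsTwoSided]

/-- Every left multiple of an arrow lies in the arrow ideal, which is nilpotent modulo `I`. -/
theorem arrowElem_mem_jacobson (hI : IsAdmissible I) (a : Total V) :
    arrowElem I a ∈ Ring.jacobson (PathAlgebra k V ⧸ I) := by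
  obtain ⟨⟨N, -, hN⟩, -⟩ := hI
  refine mem_jacobson_of_isNilpotent_mul fun y => ?_
  obtain ⟨y, rfl⟩ := Ideal.Quotient.mk_surjective y
  have h1 : y * ofPath k (arrowPath a) ∈ arrowIdealPow k V 1 := by
    rw [← zero_add 1]
    exact mul_mem_arrowIdealPow (mem_arrowIdealPow_zero y)
      (Submodule.subset_span ⟨arrowPath a, le_rfl, rfl⟩)
  refine ⟨N, ?_⟩
  rw [arrowElem, ← map_mul, ← map_pow]
  exact Ideal.Quotient.eq_zero_iff_mem.2 (hN _ (pow_mem_arrowIdealPow h1 N))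

/-- A path of length at least two contains a product of two arrows; these lie in the radical of the
quotient, so their product is in `I`. -/
theorem mem_iff_mem_arrowIdealPow_two (hI : IsAdmissible I)
    (hrad : IsRadicalSquareZero (PathAlgebra k V ⧸ I)) (x : PathAlgebra k V) :
    x ∈ I ↔ x ∈ arrowIdealPow k V 2 := by
  refine ⟨hI.2 x, fun hx => ?_⟩
  have h2 : ∀ a c : Total V, ofPath k (arrowPath c) * ofPath k (arrowPath a) ∈ I := fun a c => by
    rw [← Ideal.Quotient.eq_zero_iff_mem, map_mul]
    exact hrad _ (arrowElem_mem_jacobson hI c) _ (arrowElem_mem_jacobson hI a)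
  refine Submodule.span_induction (fun y hy => ?_) I.zero_mem (fun y z _ _ => I.add_mem)
    (fun c y _ hy => ?_) hx
  · obtain ⟨⟨x, y, p⟩, hp, rfl⟩ := hy
    match p, hp with
    | Path.cons (Path.cons p a) c, _ =>
      have h3 := I.mul_mem_right (ofPath k ⟨_, _, p⟩) (h2 ⟨_, _, a⟩ ⟨_, _, c⟩)
      rw [arrowPath, arrowPath, ofPath_mul_ofPath, ofPath_mul_ofPath] at h3
      exact h3
  · rw [Algebra.smul_def]
    exact I.mul_mem_left _ hy

theorem exists_isQuiverBasis [DecidableEq V] (hI : IsAdmissible I)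
    (hrad : IsRadicalSquareZero (PathAlgebra k V ⧸ I)) :
    ∃ b : Module.Basis (V ⊕ Total V) k (PathAlgebra k V ⧸ I),
      (∀ x, b (.inl x) = vertexElem I x) ∧ (∀ a, b (.inr a) = arrowElem I a) ∧
      IsQuiverBasis (fun a : Total V => a.left) (fun a => a.right) b := by
  have hmem := mem_iff_mem_arrowIdealPow_two hI hrad
  let f := (Ideal.Quotient.mkₐ k I).toLinearMap
  -- A relation would be an element of the squared arrow ideal with a nonzero coefficient at a path
  -- of length below two.
  have hli : LinearIndependent k fun i : V ⊕ Total V => f (ofPath k (shortPath i)) := by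
    rw [linearIndependent_iff]
    intro l hl
    have h1 : f (Finsupp.linearCombination k (fun i => ofPath k (shortPath i)) l) = 0 := by
      rw [← hl, Finsupp.apply_linearCombination]
      rfl
    have h2 := (hmem _).1 (Ideal.Quotient.eq_zero_iff_mem.1 h1)
    ext i
    have h3 := coord_eq_zero_of_mem_arrowIdealPow h2 (length_shortPath_lt i)
    rw [Finsupp.linearCombination_apply, Finsupp.sum, map_sum] at h3
    simp only [map_smul, ← pathBasis_apply, Module.Basis.coord_apply, Module.Basis.repr_self] at h3
    classical
    simpa [Finsupp.single_apply, shortPath_injective.eq_iff] using h3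
  have hspan : ⊤ ≤ Submodule.span k (Set.range fun i : V ⊕ Total V =>
      f (ofPath k (shortPath i))) := by
    rintro x -
    obtain ⟨x, rfl⟩ := Ideal.Quotient.mk_surjective x
    change f x ∈ _
    refine Submodule.span_induction ?_ ?_ (fun y z _ _ hy hz => ?_) (fun c y _ hy => ?_)
      (mem_span_range_ofPath x)
    · rintro _ ⟨p, rfl⟩
      by_cases hp : p.2.2.length < 2
      · obtain ⟨i, rfl⟩ := exists_shortPath_of_length_lt hp
        exact Submodule.subset_span ⟨i, rfl⟩
      · have : f (ofPath k p) = 0 := Ideal.Quotient.eq_zero_iff_mem.2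
          ((hmem _).2 (Submodule.subset_span ⟨p, not_lt.1 hp, rfl⟩))
        rw [this]
        exact Submodule.zero_mem _
    · rw [map_zero]; exact Submodule.zero_mem _
    · rw [map_add]; exact Submodule.add_mem _ hy hz
    · rw [map_smul]; exact Submodule.smul_mem _ _ hy
  have hv : ∀ x, Module.Basis.mk hli hspan (.inl x) = vertexElem I x := fun x =>
    Module.Basis.mk_apply hli hspan _
  have ha : ∀ a, Module.Basis.mk hli hspan (.inr a) = arrowElem I a := fun a =>
    Module.Basis.mk_apply hli hspan _
  refine ⟨Module.Basis.mk hli hspan, hv, ha, ⟨fun x y => ?_, fun x a => ?_, fun a x => ?_,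
    fun a c => ?_, ?_⟩⟩
  · rw [hv, hv, vertexElem, vertexElem, ← map_mul]
    split_ifs with h
    · subst h
      rw [vertexPath, ofPath_mul_ofPath]; rfl
    · rw [ofPath_mul_ofPath_of_ne (Ne.symm h), map_zero]
  · rw [hv, ha, vertexElem, arrowElem, ← map_mul]
    split_ifs with h
    · subst h
      rw [vertexPath, arrowPath, ofPath_mul_ofPath]; rfl
    · rw [ofPath_mul_ofPath_of_ne h, map_zero]
  · rw [hv, ha, vertexElem, arrowElem, ← map_mul]
    split_ifs with h
    · subst h
      rw [vertexPath, arrowPath, ofPath_mul_ofPath, Path.nil_comp]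
    · rw [ofPath_mul_ofPath_of_ne (Ne.symm h), map_zero]
  · rw [ha, ha]
    exact hrad _ (arrowElem_mem_jacobson hI a) _ (arrowElem_mem_jacobson hI c)
  · simp_rw [hv, vertexElem, ← map_sum]
    exact map_one _

end RadicalSquareZero

/-! ### Lengths of paths and the differential -/

section Paths

variable {V : Type u} [Quiver.{v} V]

theorem IsSubpath.length_le {z p : TPath V} (h : IsSubpath z p) :
    z.2.2.length ≤ p.2.2.length := by
  obtain ⟨s, t, h⟩ := h
  rw [h, Path.length_comp, Path.length_comp]
  omega

theorem IsSubpath.eq_of_length_le {z p : TPath V} (h : IsSubpath z p)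
    (hl : p.2.2.length ≤ z.2.2.length) : z = p := by
  obtain ⟨s, t, h⟩ := h
  obtain ⟨x, y, z⟩ := z
  obtain ⟨x', y', p⟩ := p
  dsimp only at s t h hl
  have h1 := congrArg Path.length h
  rw [Path.length_comp, Path.length_comp] at h1
  obtain rfl := Path.eq_of_length_zero s (by omega)
  obtain rfl := Path.eq_of_length_zero t (by omega)
  obtain rfl := Path.eq_nil_of_length_zero s (by omega)
  obtain rfl := Path.eq_nil_of_length_zero t (by omega)
  rw [h, Path.nil_comp, Path.comp_nil]

theorem exists_subpath_of_length_two_le {p : TPath V} (hp : 2 ≤ p.2.2.length) :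
    ∃ z : TPath V, z.2.2.length = 2 ∧ IsSubpath z p := by
  obtain ⟨x, y, p⟩ := p
  match p, hp with
  | Path.cons (Path.cons p a) c, _ =>
    exact ⟨⟨_, _, (Path.nil.cons a).cons c⟩, rfl, p, Path.nil, rfl⟩

theorem mem_minimalPaths_of_length_eq_two {S : Set (TPath V)} (hS : ∀ p ∈ S, 2 ≤ p.2.2.length)
    {p : TPath V} (hp : p ∈ S) (hl : p.2.2.length = 2) : p ∈ minimalPaths S :=
  ⟨hp, fun z hz hzp => hzp.eq_of_length_le (by rw [hl]; exact hS z hz)⟩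

theorem mem_basisPaths_of_length_lt {Z : Set (TPath V)} (hZ : ∀ p ∈ Z, 2 ≤ p.2.2.length)
    {p : TPath V} (hp : p.2.2.length < 2) : p ∈ basisPaths Z := fun z hz hzp => by
  have h1 := hZ z hz
  have h2 := hzp.length_le
  omega

theorem length_lt_of_mem_basisPaths {Z : Set (TPath V)}
    (hZ : ∀ p : TPath V, p.2.2.length = 2 → p ∈ Z) {p : TPath V} (hp : p ∈ basisPaths Z) :
    p.2.2.length < 2 := by
  by_contra! h
  obtain ⟨z, hz, hzp⟩ := exists_subpath_of_length_two_le h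
  exact hp z (hZ z hz) hzp

theorem length_arrowList {x y : V} (p : Path x y) : (arrowList p).length = p.length := by
  induction p with
  | nil => rfl
  | cons p a ih => simp [arrowList, ih]

theorem length_mapPath {W : Type*} [Quiver W] (F : V ⥤q W) {x y : V} (p : Path x y) :
    (F.mapPath p).length = p.length := by
  induction p with
  | nil => rfl
  | cons p a ih => simp [ih]

/-- Replacing an arrow by a path of the same length keeps the length of a relation, which is at
least two, whereas basis paths have length below two. -/
theorem delta1_single_eq_zero {k : Type w} [Field k] {Z : Set (TPath V)}
    (hZ : ∀ p ∈ Z, 2 ≤ p.2.2.length) (hZ' : ∀ p : TPath V, p.2.2.length = 2 → p ∈ Z)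
    (c : ParallelPair (arrowPaths V) (basisPaths Z)) (hc : c.fst.length = c.snd.length) :
    delta1 k Z (Finsupp.single c 1) = 0 := by
  rw [delta1, Finsupp.linearCombination_single, one_smul]
  funext d
  have h1 := hZ _ d.fst_mem
  have h2 := length_lt_of_mem_basisPaths hZ' d.snd_mem
  dsimp only at h1 h2
  have : IsEmpty {e : Path d.src c.src × Path c.tgt d.tgt //
      e.1.comp (c.fst.comp e.2) = d.fst ∧ e.1.comp (c.snd.comp e.2) = d.snd} := by
    refine ⟨?_⟩
    rintro ⟨e, he1, he2⟩
    have h3 := congrArg Path.length he1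
    have h4 := congrArg Path.length he2
    simp only [Path.length_comp] at h3 h4
    omega
  simp [replaceCount]

end Paths

/-! ### The glued quiver and special pairs of arrows -/

section Glued

variable {V : Type u} [Quiver.{v} V] {α β : Total V}

/-- The vertices `x` and `y` are identified when `α` and `β` are glued. -/
def VertexGlued (α β : Total V) (x y : V) : Prop :=
  x = y ∨ (x = α.left ∧ y = β.left) ∨ (x = β.left ∧ y = α.left) ∨
    (x = α.right ∧ y = β.right) ∨ (x = β.right ∧ y = α.right)

theorem VertexGlued.symm_arrows {x y : V} (h : VertexGlued α β x y) : VertexGlued β α x y := by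
  unfold VertexGlued at *
  tauto

theorem VertexGlued.mk_eq {x y : V} (h : VertexGlued α β x y) :
    (Quot.mk _ x : GluedVertex α β) = Quot.mk _ y := by
  rcases h with rfl | ⟨rfl, rfl⟩ | ⟨rfl, rfl⟩ | ⟨rfl, rfl⟩ | ⟨rfl, rfl⟩
  · rfl
  · exact Quot.sound (Or.inl ⟨rfl, rfl⟩)
  · exact Eq.symm (Quot.sound (Or.inl ⟨rfl, rfl⟩))
  · exact Quot.sound (Or.inr ⟨rfl, rfl⟩)
  · exact Eq.symm (Quot.sound (Or.inr ⟨rfl, rfl⟩))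

open Classical in
/-- The map which moves the ends of `α` to those of `β`. -/
def collapse (α β : Total V) (x : V) : V :=
  if x = α.left then β.left else if x = α.right then β.right else x

variable (hd : [α.left, α.right, β.left, β.right].Nodup)

include hd in
theorem vertexGlued_of_collapse_eq {x y : V} (h : collapse α β x = collapse α β y) :
    VertexGlued α β x y := by
  simp only [List.nodup_cons, List.mem_cons, not_or, List.not_mem_nil] at hd
  unfold collapse at h
  unfold VertexGlued
  split_ifs at h <;> simp_all

include hd in
theorem collapse_eq_of_vertexGlued {x y : V} (h : VertexGlued α β x y) :
    collapse α β x = collapse α β y := by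
  simp only [List.nodup_cons, List.mem_cons, not_or, List.not_mem_nil] at hd
  unfold collapse
  rcases h with rfl | ⟨rfl, rfl⟩ | ⟨rfl, rfl⟩ | ⟨rfl, rfl⟩ | ⟨rfl, rfl⟩
  · rfl
  all_goals split_ifs <;> simp_all

-- `collapse` is invariant under the generating relation of the quotient, so it descends and
-- separates the classes.
include hd in
theorem vertexGlued_of_mk_eq {x y : V}
    (h : (Quot.mk _ x : GluedVertex α β) = Quot.mk _ y) : VertexGlued α β x y := by
  refine vertexGlued_of_collapse_eq hd ?_
  have hr : ∀ a b : V, (a = α.left ∧ b = β.left) ∨ (a = α.right ∧ b = β.right) →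
      collapse α β a = collapse α β b := fun a b hab =>
    collapse_eq_of_vertexGlued hd (by unfold VertexGlued; tauto)
  exact congrArg (Quot.lift (collapse α β) hr) h


theorem mk_arrow_eq : (Quot.mk _ α : GluedArrow α β) = Quot.mk _ β := Quot.sound ⟨rfl, rfl⟩

theorem starArrow_eq_of_mk_eq {x y : GluedVertex α β} {b : x ⟶ y} {a : Total V}
    (h : b.1 = Quot.mk _ a) : (⟨x, y, b⟩ : Total (GluedVertex α β)) = starArrow α β a := by
  obtain ⟨b, rfl, rfl⟩ := b
  dsimp only at h
  subst h
  rfl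

theorem mk_eq_of_starArrow_eq {a c : Total V} (h : starArrow α β a = starArrow α β c) :
    (Quot.mk _ a : GluedArrow α β) = Quot.mk _ c :=
  congrArg (fun b : Total (GluedVertex α β) => b.hom.1) h

theorem eq_or_eq_of_mk_eq_mk_left {a : Total V} (h : (Quot.mk _ a : GluedArrow α β) = Quot.mk _ α) :
    a = α ∨ a = β := by
  have hr : ∀ b c : Total V, b = α ∧ c = β → (b = α ∨ b = β) = (c = α ∨ c = β) := by
    rintro b c ⟨rfl, rfl⟩
    simp
  have := congrArg (Quot.lift (fun b => b = α ∨ b = β) hr) h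
  exact this.mpr (Or.inl rfl)

theorem cons_cons_mem_image_starPath {Z : Set (TPath V)}
    (hZ : ∀ p : TPath V, p.2.2.length = 2 → p ∈ Z) {x y z : GluedVertex α β} {b₁ : x ⟶ y}
    {b₂ : y ⟶ z} {a₁ a₂ : Total V} (h₁ : b₁.1 = Quot.mk _ a₁) (h₂ : b₂.1 = Quot.mk _ a₂)
    (h : a₁.right = a₂.left) :
    (⟨x, z, (Path.nil.cons b₁).cons b₂⟩ : TPath (GluedVertex α β)) ∈ starPath α β '' Z := by
  obtain ⟨x₁, y₁, f⟩ := a₁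
  obtain ⟨y₂, z₂, g⟩ := a₂
  dsimp only at h
  subst h
  obtain ⟨b₁, rfl, rfl⟩ := b₁
  dsimp only at h₁
  subst h₁
  obtain ⟨b₂, hb, rfl⟩ := b₂
  dsimp only at h₂
  subst h₂
  exact ⟨⟨x₁, z₂, (Path.nil.cons f).cons g⟩, hZ _ rfl, rfl⟩

-- Two consecutive arrows of `Q_B` lift to arrows of `Q_A` that either compose or meet at a glued
-- vertex. In the latter case the path is new, unless one lift is the arrow excluded in
-- `newPathsAlong`; exchanging it for the other glued arrow then yields a composable lift.
include hd in
theorem mem_of_length_eq_two {Z : Set (TPath V)} (hZ : ∀ p : TPath V, p.2.2.length = 2 → p ∈ Z)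
    {p : TPath (GluedVertex α β)} (hp : p.2.2.length = 2) :
    p ∈ starPath α β '' Z ∪ newPaths α β := by
  obtain ⟨x, z, p⟩ := p
  match p, hp with
  | Path.cons (Path.cons Path.nil b₁) b₂, _ =>
    obtain ⟨a₁, h₁⟩ := Quot.exists_rep b₁.1
    obtain ⟨a₂, h₂⟩ := Quot.exists_rep b₂.1
    replace h₁ := h₁.symm
    replace h₂ := h₂.symm
    have hv : (Quot.mk _ a₁.right : GluedVertex α β) = Quot.mk _ a₂.left := by
      have e₁ := b₁.2.2
      have e₂ := b₂.2.1
      rw [h₁] at e₁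
      rw [h₂] at e₂
      exact e₁.trans e₂.symm
    have hl : arrowList ((Path.nil.cons b₁).cons b₂) =
        [starArrow α β a₁, starArrow α β a₂] := by
      simp only [arrowList, List.nil_append, List.singleton_append]
      rw [starArrow_eq_of_mk_eq h₁, starArrow_eq_of_mk_eq h₂]
    rcases vertexGlued_of_mk_eq hd hv with h | ⟨h, h'⟩ | ⟨h, h'⟩ | ⟨h, h'⟩ | ⟨h, h'⟩
    · exact Or.inl (cons_cons_mem_image_starPath hZ h₁ h₂ h)
    · by_cases ha : a₂ = β
      · subst ha
        exact Or.inl (cons_cons_mem_image_starPath hZ h₁ (h₂.trans mk_arrow_eq.symm) h)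
      · exact Or.inr (Or.inl (Or.inl ⟨a₁, a₂, h, h', ha, hl⟩))
    · by_cases ha : a₂ = α
      · subst ha
        exact Or.inl (cons_cons_mem_image_starPath hZ h₁ (h₂.trans mk_arrow_eq) h)
      · exact Or.inr (Or.inr (Or.inl ⟨a₁, a₂, h, h', ha, hl⟩))
    · by_cases ha : a₁ = α
      · subst ha
        exact Or.inl (cons_cons_mem_image_starPath hZ (h₁.trans mk_arrow_eq) h₂ h'.symm)
      · exact Or.inr (Or.inl (Or.inr (Or.inl ⟨a₁, a₂, h, ha, h', hl⟩)))
    · by_cases ha : a₁ = β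
      · subst ha
        exact Or.inl (cons_cons_mem_image_starPath hZ (h₁.trans mk_arrow_eq.symm) h₂ h'.symm)
      · exact Or.inr (Or.inr (Or.inr (Or.inl ⟨a₁, a₂, h, ha, h', hl⟩)))

theorem two_le_length_of_mem {Z : Set (TPath V)} (hZ : ∀ p ∈ Z, 2 ≤ p.2.2.length)
    {p : TPath (GluedVertex α β)} (hp : p ∈ starPath α β '' Z ∪ newPaths α β) :
    2 ≤ p.2.2.length := by
  have hnew : ∀ σ τ : Total V, p ∈ newPathsAlong α β σ τ → 2 ≤ p.2.2.length := by
    rintro σ τ (⟨_, _, _, _, _, h⟩ | ⟨_, _, _, _, _, h⟩ | ⟨_, _, _, _, h⟩) <;>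
      rw [← length_arrowList, h] <;> simp
  rcases hp with ⟨p, hp, rfl⟩ | hp | hp
  · exact (hZ p hp).trans (length_mapPath _ _).ge
  · exact hnew _ _ hp
  · exact hnew _ _ hp

include hd in
theorem mem_gluedRelations_of_length_eq_two {Z : Set (TPath V)}
    (hZ : ∀ p ∈ Z, 2 ≤ p.2.2.length) (hZ' : ∀ p : TPath V, p.2.2.length = 2 → p ∈ Z)
    (p : TPath (GluedVertex α β)) (hp : p.2.2.length = 2) : p ∈ gluedRelations Z α β :=
  mem_minimalPaths_of_length_eq_two (fun _ h => two_le_length_of_mem hZ h)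
    (mem_of_length_eq_two hd hZ' hp) hp

theorem mk_cast_eq {W : Type*} [Quiver W] {x y x' y' : W} (hx : x = x') (hy : y = y')
    (p : Path x y) : (⟨x', y', p.cast hx hy⟩ : TPath W) = ⟨x, y, p⟩ := by
  subst hx hy
  rfl

include hd in
/-- If `Z_spp = 0` in a radical square zero algebra, there are no special pairs of arrows. -/
theorem not_isSpecialPair_arrowPath {k : Type w} [Field k] {Z : Set (TPath V)}
    (hZ : ∀ p ∈ Z, 2 ≤ p.2.2.length) (hZ' : ∀ p : TPath V, p.2.2.length = 2 → p ∈ Z)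
    (hspp : Zspp k Z α β = ⊥) (a c : Total V) : ¬ IsSpecialPair Z α β a (arrowPath c) := by
  intro h
  have hB : ∀ p ∈ gluedRelations Z α β, 2 ≤ p.2.2.length :=
    fun p hp => two_le_length_of_mem hZ hp.1
  have hB' := mem_gluedRelations_of_length_eq_two hd hZ hZ'
  have h1 : (starArrow α β a).left = (starPath α β (arrowPath c)).1 := h.star_parallel.1
  have h2 : (starArrow α β a).right = (starPath α β (arrowPath c)).2.1 := h.star_parallel.2
  have hsnd := mk_cast_eq h1.symm h2.symm (starPath α β (arrowPath c)).2.2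
  -- The pair `a* ∥ c*` is a nonzero element of the span of special pairs, and `δ¹` kills it.
  let e : ParallelPair (arrowPaths (GluedVertex α β)) (basisPaths (gluedRelations Z α β)) :=
    { src := (starArrow α β a).left
      tgt := (starArrow α β a).right
      fst := (starArrow α β a).hom.toPath
      snd := (starPath α β (arrowPath c)).2.2.cast h1.symm h2.symm
      fst_mem := ⟨_, rfl⟩
      snd_mem := by
        rw [hsnd]
        exact mem_basisPaths_of_length_lt hB (by
          change (Prefunctor.mapPath _ _).length < 2
          rw [length_mapPath]
          exact Nat.lt_succ_self 1) }
  have hlen : e.fst.length = e.snd.length := by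
    have := congrArg (fun p : TPath (GluedVertex α β) => p.2.2.length) hsnd
    exact (this.trans (length_mapPath _ _)).symm
  have hmem : Finsupp.single e (1 : k) ∈ Zspp k Z α β :=
    ⟨Submodule.subset_span ⟨a, arrowPath c, e, h, rfl, hsnd, rfl⟩,
      LinearMap.mem_ker.2 (delta1_single_eq_zero hB hB' e hlen)⟩
  rw [hspp, Submodule.mem_bot, Finsupp.single_eq_zero] at hmem
  exact one_ne_zero hmem

include hd in
/-- Pairs of arrows which become parallel by the gluing, if there are no special pairs of arrows. -/
theorem parallel_of_vertexGlued {Z : Set (TPath V)} (hZ : ∀ p ∈ Z, 2 ≤ p.2.2.length)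
    (hno : ∀ a c, ¬ IsSpecialPair Z α β a (arrowPath c)) {a c : Total V}
    (hl : VertexGlued α β a.left c.left) (hr : VertexGlued α β a.right c.right) :
    (a.left = c.left ∧ a.right = c.right) ∨
    (a = α ∧ c.left = β.left ∧ c.right = β.right) ∨
    (a = β ∧ c.left = α.left ∧ c.right = α.right) ∨
    (c = α ∧ a.left = β.left ∧ a.right = β.right) ∨
    (c = β ∧ a.left = α.left ∧ a.right = α.right) := by
  -- If all the listed alternatives fail, `(a, c)` meets every condition for a special pair.
  by_contra! hcon
  obtain ⟨h0, h1, h2, h3, h4⟩ := hcon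
  have harrow : ∀ a d : Total V, arrowPath a = arrowPath d → a = d := fun a d h =>
    Sum.inr_injective (shortPath_injective (V := V) (a₁ := .inr a) (a₂ := .inr d) h)
  have hstar : starPath α β (arrowPath c) = arrowPath (starArrow α β c) := rfl
  have hstar' : starPath α β (arrowPath α) = arrowPath (starArrow α β α) := rfl
  refine hno a c
    { mem := mem_basisPaths_of_length_lt hZ (Nat.lt_succ_self 1)
      touches := ?_
      not_parallel := fun h => h0 h.1 h.2
      star_parallel := ⟨hl.mk_eq, hr.mk_eq⟩
      star_ne := ?_
      of_eq_left := fun h hp => h1 h hp.1 hp.2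
      of_eq_right := fun h hp => h2 h hp.1 hp.2
      of_path_eq_left := fun h hp => h3 (harrow _ _ h) hp.1 hp.2
      of_path_eq_right := fun h hp => h4 (harrow _ _ h) hp.1 hp.2 }
  · simp only [Set.mem_insert_iff, Set.mem_singleton_iff]
    rcases hl with hl | ⟨hl, -⟩ | ⟨hl, -⟩ | ⟨hl, -⟩ | ⟨hl, -⟩
    · rcases hr with hr | ⟨hr, -⟩ | ⟨hr, -⟩ | ⟨hr, -⟩ | ⟨hr, -⟩
      · exact (h0 hl hr).elim
      all_goals simp [hr]
    all_goals simp [hl]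
  -- Both arrows would lie in `{α, β}`, and each of the four combinations is among the excluded
  -- alternatives.
  · rintro ⟨ha, hc⟩
    rw [hstar, hstar'] at hc
    have hc' : starArrow α β c = starArrow α β α := Sum.inr_injective
      (shortPath_injective (V := GluedVertex α β) (a₁ := .inr _) (a₂ := .inr _) hc)
    rcases eq_or_eq_of_mk_eq_mk_left (mk_eq_of_starArrow_eq ha) with rfl | rfl <;>
      rcases eq_or_eq_of_mk_eq_mk_left (mk_eq_of_starArrow_eq hc') with rfl | rfl
    · exact h0 rfl rfl
    · exact h1 rfl rfl rfl
    · exact h2 rfl rfl rfl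
    · exact h0 rfl rfl

end Glued

/-! ### The monomial relations of `A` -/

section Relations

variable {k : Type w} [Field k] {V : Type u} [Quiver.{v} V] [Fintype V]
  {I : Ideal (PathAlgebra k V)}

theorem two_le_length_of_ofPath_mem (hI : IsAdmissible I) {p : TPath V} (hp : ofPath k p ∈ I) :
    2 ≤ p.2.2.length := by
  by_contra! h
  have h1 := coord_eq_zero_of_mem_arrowIdealPow (hI.2 _ hp) h
  rw [← pathBasis_apply, Module.Basis.coord_apply, Module.Basis.repr_self,
    Finsupp.single_eq_same] at h1
  exact one_ne_zero h1

theorem two_le_length_of_mem_monomialRelations (hI : IsAdmissible I) (p : TPath V)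
    (hp : p ∈ monomialRelations I) : 2 ≤ p.2.2.length :=
  two_le_length_of_ofPath_mem hI hp.1

theorem mem_monomialRelations_of_length_eq_two [I.IsTwoSided] (hI : IsAdmissible I)
    (hrad : IsRadicalSquareZero (PathAlgebra k V ⧸ I)) (p : TPath V) (hp : p.2.2.length = 2) :
    p ∈ monomialRelations I :=
  mem_minimalPaths_of_length_eq_two (fun _ hq => two_le_length_of_ofPath_mem hI hq)
    ((mem_iff_mem_arrowIdealPow_two hI hrad _).2 (Submodule.subset_span ⟨p, hp.ge, rfl⟩)) hp

end Relations

/-! ### Blocks and functions constant along arrows -/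

section Blocks

variable {k : Type*} [Field k] {R : Type*} [Ring R] [Algebra k R] {V E : Type*} [Fintype V]
  [DecidableEq V] {s t : E → V} {b : Module.Basis (V ⊕ E) k R}

theorem IsCentralIdempotent.mul {c d : R} (hc : IsCentralIdempotent c)
    (hd : IsCentralIdempotent d) : IsCentralIdempotent (c * d) := by
  refine ⟨?_, fun x => ?_⟩
  · rw [mul_assoc, ← mul_assoc d, hd.2 c, mul_assoc, hd.1, ← mul_assoc, hc.1]
  · rw [mul_assoc, hd.2, ← mul_assoc, hc.2, mul_assoc]

theorem IsCentralIdempotent.one_sub {c : R} (hc : IsCentralIdempotent c) :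
    IsCentralIdempotent (1 - c) := by
  refine ⟨?_, fun x => ?_⟩
  · rw [mul_sub, mul_one, sub_mul, one_mul, hc.1, sub_self, sub_zero]
  · rw [mul_sub, mul_one, sub_mul, one_mul, hc.2]

/-- A function on the vertices which is constant on the arrows takes the same values at the ends
of arrows in the same block. -/
theorem IsQuiverBasis.eq_of_sameBlock (h : IsQuiverBasis s t b) {a c : E}
    (hac : SameBlock (b (.inr a)) (b (.inr c))) {f : V → k} (hf : ∀ d, f (t d) = f (s d)) :
    f (s a) = f (s c) := by
  classical
  by_contra hne
  obtain ⟨e, ⟨he, -, hprim⟩, hea, hec⟩ := hac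
  -- The indicator of the level set of `f` through `s a` defines a central idempotent `z` with `z a
  -- = a` and `z c = 0`; it would split the primitive idempotent `e`.
  obtain ⟨g, hg⟩ : ∃ g : V → k, ∀ x, g x = if f x = f (s a) then (1 : k) else 0 :=
    ⟨_, fun _ => rfl⟩
  let z : R := ∑ x, g x • b (.inl x)
  have hzx : ∀ x, z * b (.inl x) = g x • b (.inl x) :=
    fun x => by simp [z, Finset.sum_mul, h.vertex_mul_vertex]
  have hxz : ∀ x, b (.inl x) * z = g x • b (.inl x) :=
    fun x => by simp [z, Finset.mul_sum, h.vertex_mul_vertex]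
  have hcoord : ∀ x, b.coord (.inl x) z = g x :=
    fun x => by simp [z, Finsupp.single_apply]
  have hz : IsCentralIdempotent z := by
    constructor
    · conv_lhs => rw [show z * z = z * ∑ x, _ from rfl, Finset.mul_sum]
      refine Finset.sum_congr rfl fun x _ => ?_
      rw [mul_smul_comm, hzx, smul_smul, hg]
      split_ifs <;> simp
    · have : LinearMap.mulLeft k z = LinearMap.mulRight k z := by
        refine b.ext ?_
        rintro (x | d)
        · exact (hzx x).trans (hxz x).symm
        · rw [LinearMap.mulLeft_apply, LinearMap.mulRight_apply, h.mul_arrow, h.arrow_mul,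
            hcoord, hcoord, hg (t d), hg (s d), hf]
      exact LinearMap.congr_fun this
  have hza : z * b (.inr a) = b (.inr a) := by
    rw [h.mul_arrow, hcoord, hg, hf, if_pos rfl, one_smul]
  have hzc : z * b (.inr c) = 0 := by
    rw [h.mul_arrow, hcoord, hg, hf, if_neg (Ne.symm hne), zero_smul]
  rcases hprim (e * z) (e * (1 - z)) (he.mul hz) (he.mul hz.one_sub)
    (by rw [mul_assoc, ← mul_assoc z, hz.2 e, mul_assoc, mul_sub, mul_one, hz.1, sub_self,
      mul_zero, mul_zero]) (by rw [← mul_add, add_sub_cancel, mul_one]) with h0 | h0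
  · refine b.ne_zero (.inr a) ?_
    rw [← hea, ← hza, ← mul_assoc, h0, zero_mul]
  · refine b.ne_zero (.inr c) ?_
    have h1 : (1 - z) * b (.inr c) = b (.inr c) := by rw [sub_mul, one_mul, hzc, sub_zero]
    rw [← hec, ← h1, ← mul_assoc, h0, zero_mul]

end Blocks

/-! ### The glued algebra -/

section Main

variable {k : Type u} [Field k] {V : Type v} [Fintype V] [Quiver.{w} V]

instance finite_total [∀ x y : V, Finite (x ⟶ y)] : Finite (Total V) :=
  Finite.of_injective (fun a : Total V => (⟨a.left, a.right, a.hom⟩ : Σ x y : V, (x ⟶ y)))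
    fun a c h => by
      obtain ⟨x, y, a⟩ := a
      obtain ⟨x', y', c⟩ := c
      cases h
      rfl

theorem gluedAlgebra_comm (I : Ideal (PathAlgebra k V)) [I.IsTwoSided] (α β : Total V) :
    gluedAlgebra I α β = gluedAlgebra I β α := by
  unfold gluedAlgebra
  congr 2
  · rw [add_comm (vertexElem I α.left), add_comm (vertexElem I α.right),
      add_comm (arrowElem I α)]
    congr 2
    ext x
    refine exists_congr fun y => and_congr (not_congr ?_) Iff.rfl
    simp only [Set.mem_insert_iff, Set.mem_singleton_iff]
    tauto
  · ext x
    refine exists_congr fun a => ?_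
    tauto

section Collapse

variable {α β : Total V} (hd : [α.left, α.right, β.left, β.right].Nodup)

include hd

omit [Fintype V] in
theorem collapse_ne (x : V) : collapse α β x ≠ α.left ∧ collapse α β x ≠ α.right := by
  simp only [List.nodup_cons, List.mem_cons, not_or, List.not_mem_nil] at hd
  unfold collapse
  split_ifs <;> simp_all [eq_comm]

/-- The vertices of the glued quiver, represented by the vertices other than the ends of `α`. -/
def collapseVertex (x : V) : {x : V // x ≠ α.left ∧ x ≠ α.right} :=
  ⟨collapse α β x, collapse_ne hd x⟩

omit [Fintype V] in
theorem ne_of_nodup : β ≠ α := by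
  rintro rfl
  simp at hd

open Classical in
/-- The arrows of the glued quiver, represented by the arrows other than `α`. -/
def collapseArrow (a : Total V) : {a : Total V // a ≠ α} :=
  if ha : a = α then ⟨β, ne_of_nodup hd⟩ else ⟨a, ha⟩

omit [Fintype V] in
theorem collapseArrow_of_ne {a : Total V} (ha : a ≠ α) : collapseArrow hd a = ⟨a, ha⟩ :=
  dif_neg ha

omit [Fintype V] in
theorem collapseArrow_self : collapseArrow hd α = ⟨β, ne_of_nodup hd⟩ := dif_pos rfl

end Collapse

-- The asymmetric case where `α` has no parallel companion: `α` can be discarded, and `Q_B` is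
-- modelled on the arrows other than `α` and the vertices other than its ends.
open Classical in
theorem nonempty_HH1_gluedAlgebra_equiv [CharZero k] [∀ x y : V, Finite (x ⟶ y)]
    {I : Ideal (PathAlgebra k V)} [I.IsTwoSided] (hI : IsAdmissible I)
    (hrad : IsRadicalSquareZero (PathAlgebra k V ⧸ I)) {α β : Total V}
    (hd : [α.left, α.right, β.left, β.right].Nodup)
    (hblock : SameBlock (arrowElem I α) (arrowElem I β))
    (hα : ∀ a : Total V, a.left = α.left → a.right = α.right → a = α)
    (hpar : ∀ a c : Total V, VertexGlued α β a.left c.left → VertexGlued α β a.right c.right →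
      a ≠ α → c ≠ α → a.left = c.left ∧ a.right = c.right) :
    Nonempty (HH1 k (gluedAlgebra I α β) ≃ₗ⁅k⁆ (HH1 k (PathAlgebra k V ⧸ I) × k)) := by
  have := Fintype.ofFinite (Total V)
  obtain ⟨b, hbv, hba, hb⟩ := exists_isQuiverBasis hI hrad
  have hd' := hd
  simp only [List.nodup_cons, List.mem_cons, not_or, List.not_mem_nil, not_false_eq_true,
    and_true, List.nodup_nil] at hd'
  obtain ⟨⟨h12, h13, h14⟩, ⟨h23, h24⟩, h34⟩ := hd'
  let π := collapseVertex hd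
  let ρ := collapseArrow hd
  let s : {a : Total V // a ≠ α} → {x : V // x ≠ α.left ∧ x ≠ α.right} := fun a => π a.1.left
  let t : {a : Total V // a ≠ α} → {x : V // x ≠ α.left ∧ x ≠ α.right} := fun a => π a.1.right
  have hπ : ∀ x y, π x = π y ↔ VertexGlued α β x y := fun x y =>
    ⟨fun h => vertexGlued_of_collapse_eq hd (congrArg Subtype.val h),
      fun h => Subtype.ext (collapse_eq_of_vertexGlued hd h)⟩
  have hcol : ∀ v : {x : V // x ≠ α.left ∧ x ≠ α.right}, π v.1 = v := fun v =>
    Subtype.ext (by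
      change collapse α β v.1 = v.1
      rw [collapse, if_neg v.2.1, if_neg v.2.2])
  have hl : π α.left = π β.left := (hπ _ _).2 (Or.inr (Or.inl ⟨rfl, rfl⟩))
  have hr : π α.right = π β.right := (hπ _ _).2 (Or.inr (Or.inr (Or.inr (Or.inl ⟨rfl, rfl⟩))))
  have hs : ∀ a, π a.left = s (ρ a) := fun a => by
    by_cases ha : a = α
    · subst ha; simp only [ρ, collapseArrow_self]; exact hl
    · simp only [ρ, collapseArrow_of_ne hd ha, s]
  have ht : ∀ a, π a.right = t (ρ a) := fun a => by
    by_cases ha : a = α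
    · subst ha; simp only [ρ, collapseArrow_self]; exact hr
    · simp only [ρ, collapseArrow_of_ne hd ha, t]
  have hπs : Function.Surjective π := fun v => ⟨v.1, hcol v⟩
  have hρs : Function.Surjective ρ := fun a => ⟨a.1, collapseArrow_of_ne hd a.2⟩
  -- The defining generators of `B` are exactly the fibre sums of the collapse.
  have hB : gluedAlgebra I α β = Algebra.adjoin k (Set.range (fibreSum b π ρ)) := by
    have hfib : ∀ v y : V, ∀ hv : v ≠ α.left ∧ v ≠ α.right, π y = ⟨v, hv⟩ ↔
        y = v ∨ (y = α.left ∧ v = β.left) ∨ (y = α.right ∧ v = β.right) := fun v y hv => by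
      rw [← hcol ⟨v, hv⟩, hπ]
      unfold VertexGlued
      have := hv.1
      have := hv.2
      tauto
    have hsum1 : fibreSum b π ρ (.inl ⟨β.left, Ne.symm h13, Ne.symm h23⟩) =
        vertexElem I α.left + vertexElem I β.left := by
      rw [fibreSum_inl, ← hbv, ← hbv, ← Finset.sum_pair (f := fun x => b (.inl x)) h13]
      refine Finset.sum_congr (Finset.ext fun y => ?_) fun _ _ => rfl
      simp only [Finset.mem_filter, Finset.mem_univ, true_and, hfib, Finset.mem_insert,
        Finset.mem_singleton]
      tauto
    have hsum2 : fibreSum b π ρ (.inl ⟨β.right, Ne.symm h14, Ne.symm h24⟩) =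
        vertexElem I α.right + vertexElem I β.right := by
      rw [fibreSum_inl, ← hbv, ← hbv, ← Finset.sum_pair (f := fun x => b (.inl x)) h24]
      refine Finset.sum_congr (Finset.ext fun y => ?_) fun _ _ => rfl
      simp only [Finset.mem_filter, Finset.mem_univ, true_and, hfib, Finset.mem_insert,
        Finset.mem_singleton]
      have := Ne.symm h34
      tauto
    have hsum3 : ∀ v (hv : v ≠ α.left ∧ v ≠ α.right), v ≠ β.left → v ≠ β.right →
        fibreSum b π ρ (.inl ⟨v, hv⟩) = vertexElem I v := by
      intro v hv h1 h2
      rw [fibreSum_inl, ← hbv, ← Finset.sum_singleton (fun x => b (.inl x)) v]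
      refine Finset.sum_congr (Finset.ext fun y => ?_) fun _ _ => rfl
      simp only [Finset.mem_filter, Finset.mem_univ, true_and, hfib, Finset.mem_singleton]
      tauto
    have hfib' : ∀ c a : Total V, ∀ hc : c ≠ α, ρ a = ⟨c, hc⟩ ↔ a = c ∨ (a = α ∧ c = β) := by
      intro c a hc
      by_cases ha : a = α
      · subst ha
        simp only [ρ, collapseArrow_self, Subtype.mk.injEq]
        constructor
        · exact fun h => Or.inr ⟨trivial, h.symm⟩
        · rintro (h | h)
          exacts [(hc h.symm).elim, h.2.symm]
      · simp only [ρ, collapseArrow_of_ne hd ha, Subtype.mk.injEq]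
        tauto
    have hsum4 : fibreSum b π ρ (.inr ⟨β, ne_of_nodup hd⟩) = arrowElem I α + arrowElem I β := by
      rw [fibreSum_inr, ← hba, ← hba, ← Finset.sum_pair (f := fun x => b (.inr x)) (ne_of_nodup hd).symm]
      refine Finset.sum_congr (Finset.ext fun y => ?_) fun _ _ => rfl
      simp only [Finset.mem_filter, Finset.mem_univ, true_and, hfib', Finset.mem_insert,
        Finset.mem_singleton]
      tauto
    have hsum5 : ∀ c (hc : c ≠ α), c ≠ β → fibreSum b π ρ (.inr ⟨c, hc⟩) = arrowElem I c := by
      intro c hc h1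
      rw [fibreSum_inr, ← hba, ← Finset.sum_singleton (fun x => b (.inr x)) c]
      refine Finset.sum_congr (Finset.ext fun y => ?_) fun _ _ => rfl
      simp only [Finset.mem_filter, Finset.mem_univ, true_and, hfib', Finset.mem_singleton]
      tauto
    refine congrArg (Algebra.adjoin k) (Set.Subset.antisymm ?_ ?_)
    · rintro x (((h | h | h) | ⟨y, hy, rfl⟩) | ⟨a, h1, h2, rfl⟩)
      · exact ⟨_, hsum1.trans h.symm⟩
      · exact ⟨_, hsum2.trans h.symm⟩
      · exact ⟨_, hsum4.trans (Set.mem_singleton_iff.1 h).symm⟩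
      · simp only [Set.mem_insert_iff, Set.mem_singleton_iff, not_or] at hy
        exact ⟨_, hsum3 y ⟨hy.1, hy.2.1⟩ hy.2.2.1 hy.2.2.2⟩
      · exact ⟨_, hsum5 a h1 h2⟩
    · rintro _ ⟨⟨v, hv⟩ | ⟨c, hc⟩, rfl⟩
      · by_cases h1 : v = β.left
        · subst h1
          exact Or.inl (Or.inl (Or.inl hsum1))
        · by_cases h2 : v = β.right
          · subst h2
            exact Or.inl (Or.inl (Or.inr (Or.inl hsum2)))
          · exact Or.inl (Or.inr ⟨v, by simp [hv.1, hv.2, h1, h2], hsum3 v hv h1 h2⟩)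
      · by_cases h1 : c = β
        · subst h1
          exact Or.inl (Or.inl (Or.inr (Or.inr hsum4)))
        · exact Or.inr ⟨c, hc, h1, hsum5 c hc h1⟩
  obtain ⟨b', hb'⟩ := hb.exists_adjoin_fibreSum hs ht hπs hρs
  rw [hB]
  refine hb'.nonempty_HH1_equiv_prod hb (j := Subtype.val) (π := π) (a₀ := α)
    (a₁ := ⟨β, ne_of_nodup hd⟩) Subtype.val_injective (fun a => by simp)
    (fun a h => (hα a (congrArg Prod.fst h).symm (congrArg Prod.snd h).symm).symm) ?_ hπs
    (fun _ => rfl) (fun _ => rfl) hl hr ?_ ?_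
  · intro a c
    constructor
    · intro h
      exact Prod.ext (congrArg π (congrArg Prod.fst h)) (congrArg π (congrArg Prod.snd h))
    · intro h
      obtain ⟨h1, h2⟩ := hpar a.1 c.1 ((hπ _ _).1 (congrArg Prod.fst h))
        ((hπ _ _).1 (congrArg Prod.snd h)) a.2 c.2
      exact Prod.ext h1 h2
  -- The common block gives equal values at the starts of `α` and `β`; constancy along the two
  -- arrows carries this to their ends.
  · intro f hf x y hxy
    rw [← hba, ← hba] at hblock
    have h1 : f α.left = f β.left := hb.eq_of_sameBlock hblock hf
    have h2 : f α.right = f β.right := by rw [hf α, hf β, h1]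
    rcases (hπ x y).1 hxy with rfl | ⟨rfl, rfl⟩ | ⟨rfl, rfl⟩ | ⟨rfl, rfl⟩ | ⟨rfl, rfl⟩
    exacts [rfl, h1, h1.symm, h2, h2.symm]
  · have h1 : (Finset.univ.filter fun x : V => x ≠ α.left ∧ x ≠ α.right) =
        Finset.univ \ {α.left, α.right} := by
      ext x
      simp
    have h2 := Finset.card_sdiff_add_card_eq_card
      (Finset.subset_univ ({α.left, α.right} : Finset V))
    rw [Finset.card_pair h12, ← h1, Finset.card_univ] at h2
    rw [Fintype.card_subtype, ← h2]

end Main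

end GluingArrows

end

open GluingArrows in
theorem mainTheorem4 {k : Type*} [Field k] [CharZero k]
    {V : Type*} [Fintype V] [Quiver V] [∀ x y : V, Finite (x ⟶ y)]
    (I : Ideal (PathAlgebra k V)) [I.IsTwoSided]
    (hI : IsAdmissible I)
    (hrad : IsRadicalSquareZero (PathAlgebra k V ⧸ I))
    (α β : Quiver.Total V)
    (hdistinct : [α.left, α.right, β.left, β.right].Nodup)
    (hblock : SameBlock (arrowElem I α) (arrowElem I β))
    (hspp : Zspp k (monomialRelations I) α β = ⊥) :
    Nonempty (HH1 k (gluedAlgebra I α β) ≃ₗ⁅k⁆ (HH1 k (PathAlgebra k V ⧸ I) × k)) := by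
  have hZ := two_le_length_of_mem_monomialRelations hI
  have hno := not_isSpecialPair_arrowPath hdistinct hZ
    (mem_monomialRelations_of_length_eq_two hI hrad) hspp
  have hd := hdistinct
  simp only [List.nodup_cons, List.mem_cons, not_or, List.not_mem_nil, not_false_eq_true,
    and_true, List.nodup_nil] at hd
  obtain ⟨⟨h12, h13, h14⟩, ⟨h23, h24⟩, h34⟩ := hd
  -- The comparison needs a glued arrow alone in its parallel class. If `α` is not, the roles of `α`
  -- and `β` are exchanged.
  by_cases hα : ∀ a : Total V, a.left = α.left → a.right = α.right → a = α
  · refine nonempty_HH1_gluedAlgebra_equiv hI hrad hdistinct hblock hα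
      fun a c hl hr ha hc => ?_
    rcases parallel_of_vertexGlued hdistinct hZ hno hl hr with h | h | h | h | h
    exacts [h, (ha h.1).elim, (hc (hα c h.2.1 h.2.2)).elim, (hc h.1).elim,
      (ha (hα a h.2.1 h.2.2)).elim]
  · push Not at hα
    obtain ⟨a₀, hl₀, hr₀, ha₀⟩ := hα
    -- A companion `a₀` of `α` becomes parallel to each arrow parallel to `β`; in the absence of
    -- special pairs this forces such an arrow to be `β`.
    have hβ : ∀ c : Total V, c.left = β.left → c.right = β.right → c = β := by
      intro c hl hr
      rcases parallel_of_vertexGlued hdistinct hZ hno (a := a₀) (c := c)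
        (Or.inr (Or.inl ⟨hl₀, hl⟩))
        (Or.inr (Or.inr (Or.inr (Or.inl ⟨hr₀, hr⟩)))) with h | h | h | h | h
      · exact (h13 (hl₀.symm.trans (h.1.trans hl))).elim
      · exact (ha₀ h.1).elim
      · exact (h13 (h.2.1.symm.trans hl)).elim
      · exact (h13 (hl₀.symm.trans h.2.1)).elim
      · exact h.1
    have hdistinct' : [β.left, β.right, α.left, α.right].Nodup :=
      (List.nodup_append_comm (l₁ := [α.left, α.right])).1 hdistinct
    obtain ⟨e, he, he1, he2⟩ := hblock
    rw [gluedAlgebra_comm]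
    refine nonempty_HH1_gluedAlgebra_equiv hI hrad hdistinct' ⟨e, he, he2, he1⟩ hβ
      fun a c hl hr ha hc => ?_
    rcases parallel_of_vertexGlued hdistinct hZ hno hl.symm_arrows hr.symm_arrows with h | h | h | h | h
    exacts [h, (hc (hβ c h.2.1 h.2.2)).elim, (ha h.1).elim, (ha (hβ a h.2.1 h.2.2)).elim,
      (hc h.1).elim]
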